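/- Fix two numbers $\delta_0,\rho_0\in(0,1)$ and put $$\alpha_0=\frac{(1-\rho_0)(1-\delta_0)^2}{\rho_0},\qquad \beta_0=\frac{(1-\rho_0)(1-\delta_0)}{\rho_0}.$$ A standardized Gaussian vector is a jointly Gaussian random vector $X=(X_1,\dots,X_n)$ (possibly with singular covariance) with $\mathbb E[X_i]=0$ and $\operatorname{var}(X_i)=1$ for all $i$; $R=(R_{ij})$ denotes its correlation matrix, and $\|X\|_\infty=\max_{1\le i\le n}|X_i|$. Call a constant $C>0$ admissible for $(\delta_0,\rho_0)$ if $$\mathbb P\Big(\max_{1\le i\le n}X_i\le \delta_0\sqrt{2(1-\rho_0)\log n}\Big)\le C\,n^{-\alpha_0}(\log n)^{\frac{\beta_0-1}{2}}$$ for every $n\ge 2$ and every standardized Gaussian vector $X\in\mathbb R^n$ with $\max_{i\ne j}R_{ij}\le\rho_0$. Then an admissible constant $C>0$ (depending only on $(\delta_0,\rho_0)$) exists. Moreover, for every admissible $C$ and every standardized Gaussian vector $X\in\mathbb R^n$ the following hold. (1) If $n\ge 1$ and $|R_{ij}|\le\rho_0$ for all $i\ne j$, then $$\mathbb P\Big(\|X\|_\infty\le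 \delta_0\sqrt{2(1-\rho_0)\log(2n)}\Big)\le C\,(2n)^{-\alpha_0}\,\log(2n)^{\frac{\beta_0-1}{2}}.$$ (2) If $n\ge 2$ and $R_{ij}\in[0,\rho_0]$ for all $i\ne j$, then $$\mathbb P\Big(\|X\|_\infty\le \delta_0\sqrt{2(1-\rho_0)\log n}\Big)\le C^2\,n^{-2\alpha_0}\,(\log n)^{\beta_0-1}.$$ -/

import Mathlib

open MeasureTheory ProbabilityTheory

noncomputable section

/-- `X = (X₁, …, Xₙ)` is a (possibly degenerate) jointly Gaussian random vector on `(Ω, P)` whose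
entries are standardized: mean `0` and variance `1`. -/
structure IsStdGaussianVector {Ω : Type*} [MeasurableSpace Ω] {n : ℕ} (P : Measure Ω)
    (X : Ω → Fin n → ℝ) : Prop where
  hasGaussianLaw : HasGaussianLaw X P
  mean_eq_zero : ∀ i, ∫ ω, X ω i ∂P = 0
  variance_eq_one : ∀ i, Var[fun ω => X ω i; P] = 1

/-- The correlation matrix `R` of a random vector. -/
def corrMatrix {Ω : Type*} [MeasurableSpace Ω] {n : ℕ} (P : Measure Ω)
    (X : Ω → Fin n → ℝ) : Matrix (Fin n) (Fin n) ℝ :=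
  fun i j => cov[fun ω => X ω i, fun ω => X ω j; P] /
    (√(Var[fun ω => X ω i; P]) * √(Var[fun ω => X ω j; P]))

/-- The maximum `M_n(X) = max_{1 ≤ i ≤ n} X_i` of a vector (used only for `n ≥ 2`, where it is
the maximum of a nonempty finite family). -/
def vecMax {n : ℕ} (x : Fin n → ℝ) : ℝ := ⨆ i, x i

/-- `α₀ = (1 - ρ₀)(1 - δ₀)² / ρ₀`. -/
def alphaZero (δ₀ ρ₀ : ℝ) : ℝ := (1 - ρ₀) * (1 - δ₀) ^ 2 / ρ₀

/-- `β₀ = (1 - ρ₀)(1 - δ₀) / ρ₀`. -/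
def betaZero (δ₀ ρ₀ : ℝ) : ℝ := (1 - ρ₀) * (1 - δ₀) / ρ₀

/-- `C` is a constant in the lower-tail bound for the maximum: the bound
`P(max_i X_i ≤ δ₀ √(2(1-ρ₀) log n)) ≤ C n^(-α₀) (log n)^((β₀-1)/2)`
holds for all `n ≥ 2` and all standardized Gaussian vectors with `max_{i ≠ j} R_ij ≤ ρ₀`.
Only the law of `X` matters, so probability spaces in `Type` suffice
(for example `Fin n → ℝ` itself). -/
def IsMaxBoundConstant (δ₀ ρ₀ C : ℝ) : Prop :=
  ∀ n : ℕ, 2 ≤ n → ∀ (Ω : Type) [MeasurableSpace Ω] (P : Measure Ω) (X : Ω → Fin n → ℝ),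
    IsStdGaussianVector P X →
    (∀ i j, i ≠ j → corrMatrix P X i j ≤ ρ₀) →
    P.real {ω | vecMax (X ω) ≤ δ₀ * √(2 * (1 - ρ₀) * Real.log n)} ≤
      C * (n : ℝ) ^ (-alphaZero δ₀ ρ₀) * Real.log n ^ ((betaZero δ₀ ρ₀ - 1) / 2)

end

/-! Everything rests on Slepian's inequality: among centred Gaussian vectors with the same
variances, raising covariances can only raise `P(∀ i, X i ≤ u)`. It is proved here by Lindeberg
replacement. A centred Gaussian vector is a sum of `m` independent copies of itself scaled by `1 /
√m`. Exchanging one summand for its counterpart changes the expectation of `∏ g (x i)` at second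
order by the covariance difference times mixed derivatives, which are nonnegative for nonincreasing
`g ≥ 0`. The third order errors add up to `O(m ^ (-1/2))`. Smooth cutoffs then give orthants
(`slepian`).

For an admissible constant, compare `X` with the equicorrelated vector `√(1-ρ) ξ i - √ρ w`.
Conditioning on `w` leaves the integral of `Φ(δ √(2 log n) + c w) ^ n` with `c ^ 2 = ρ / (1-ρ)`. The
power is negligible until its argument nears the typical maximum `√(2 log n)`, lowered by a log-log
correction, so the integral is of the order of a normal tail at about `(1-δ) √(2 log n) / c`. This
tail gives the power of `n`; the correction and the factor `1 / w` of the tail give the power of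
`log n` (`integral_stdNormalCDF_pow_le`).

Both bounds on the sup norm come from the `2n` coordinates of `(X, -X)`. For (1), this vector is
itself standardized with off-diagonal correlations at most `ρ`. For (2), Slepian compares it with
`(X, -X')`, where `X'` is an independent copy: the mixed covariances `-R i j` are at most `0`, so
the probability is at most a product of two one-sided ones. -/

/-! ### Taylor expansion of product functions -/

/-- A second order Taylor estimate on `[0, 1]` with a bounded third derivative. -/
lemma abs_taylor_two_le {f f₁ f₂ f₃ : ℝ → ℝ} {B : ℝ}
    (h₀ : ∀ t, HasDerivAt f (f₁ t) t) (h₁ : ∀ t, HasDerivAt f₁ (f₂ t) t)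
    (h₂ : ∀ t, HasDerivAt f₂ (f₃ t) t) (hB : ∀ t, |f₃ t| ≤ B) :
    |f 1 - f 0 - f₁ 0 - f₂ 0 / 2| ≤ B := by
  have hB0 : 0 ≤ B := (abs_nonneg _).trans (hB 0)
  -- The mean value inequality, used three times on successive Taylor remainders. The sharp constant
  -- `B / 6` is not needed.
  have mv : ∀ {g g' : ℝ → ℝ}, (∀ t, HasDerivAt g (g' t) t) →
      (∀ t ∈ Set.Icc (0 : ℝ) 1, |g' t| ≤ B) → ∀ t ∈ Set.Icc (0 : ℝ) 1, |g t - g 0| ≤ B := by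
    intro g g' hg hg' t ht
    have h := (convex_Icc (0 : ℝ) 1).norm_image_sub_le_of_norm_hasDerivWithin_le
      (fun x _ => (hg x).hasDerivWithinAt) hg' (Set.left_mem_Icc.2 zero_le_one) ht
    rw [Real.norm_eq_abs, Real.norm_eq_abs, sub_zero, abs_of_nonneg ht.1] at h
    exact h.trans (mul_le_of_le_one_right hB0 ht.2)
  have b₂ := mv h₂ fun t _ => hB t
  have b₁ := mv (g := fun t => f₁ t - t * f₂ 0) (g' := fun t => f₂ t - 1 * f₂ 0)
    (fun t => (h₁ t).sub ((hasDerivAt_id t).mul_const _)) (by simpa using b₂)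
  have b₀ := mv (g := fun t => f t - t * f₁ 0 - t ^ 2 * (f₂ 0 / 2))
    (g' := fun t => f₁ t - 1 * f₁ 0 - (2 * t ^ 1 * 1) * (f₂ 0 / 2))
    (fun t => ((h₀ t).sub ((hasDerivAt_id t).mul_const _)).sub
      (((hasDerivAt_id t).pow 2).mul_const _)) (by
      intro t ht
      convert b₁ t ht using 2
      ring)
  convert b₀ 1 (Set.right_mem_Icc.2 zero_le_one) using 2
  ring

section ProductFunctions

variable {ι : Type*} [Fintype ι] [DecidableEq ι]

/-- The multi-index `s` records the order of differentiation in each factor. A derivative along `v`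
raises one order at a time, so the family is closed under differentiation and the formula can be
iterated. -/
lemma hasDerivAt_prod_line {g : ℕ → ℝ → ℝ} (hg : ∀ k x, HasDerivAt (g k) (g (k + 1) x) x)
    (s : ι → ℕ) (b v : ι → ℝ) (t : ℝ) :
    HasDerivAt (fun t => ∏ i, g (s i) (b i + t * v i))
      (∑ i, v i * ∏ j, g ((s + Pi.single i 1 : ι → ℕ) j) (b j + t * v j)) t := by
  have h : ∀ i ∈ Finset.univ, HasDerivAt (fun t => g (s i) (b i + t * v i))
      (g (s i + 1) (b i + t * v i) * v i) t := by
    intro i _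
    have h1 : HasDerivAt (fun t : ℝ => b i + t * v i) (v i) t := by
      simpa using ((hasDerivAt_id t).mul_const (v i)).const_add (b i)
    exact (hg (s i) _).comp t h1
  refine (HasDerivAt.fun_finsetProd h).congr_deriv (Finset.sum_congr rfl fun i _ => ?_)
  rw [← Finset.mul_prod_erase Finset.univ _ (Finset.mem_univ i), smul_eq_mul]
  have : ∏ j ∈ Finset.univ.erase i, g ((s + Pi.single i 1 : ι → ℕ) j) (b j + t * v j) =
      ∏ j ∈ Finset.univ.erase i, g (s j) (b j + t * v j) := by
    refine Finset.prod_congr rfl fun j hj => ?_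
    simp [Pi.single_eq_of_ne (Finset.ne_of_mem_erase hj)]
  rw [this]
  simp only [Pi.add_apply, Pi.single_eq_same]
  ring

/-- The constant in the third order remainder for a product of one-variable functions. -/
def thirdOrderBound (ι : Type*) [Fintype ι] [DecidableEq ι] (M : ℕ → ℝ) : ℝ :=
  ∑ i : ι, ∑ j : ι, ∑ k : ι, ∏ l : ι,
    M ((Pi.single i 1 + Pi.single j 1 + Pi.single k 1 : ι → ℕ) l)

lemma abs_prod_taylor_two_le {g : ℕ → ℝ → ℝ} {M : ℕ → ℝ}
    (hg : ∀ k x, HasDerivAt (g k) (g (k + 1) x) x) (hM : ∀ k x, |g k x| ≤ M k) (b v : ι → ℝ) :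
    |∏ i, g 0 (b i + v i) - ∏ i, g 0 (b i) -
        ∑ i, v i * ∏ l, g ((Pi.single i 1 : ι → ℕ) l) (b l) -
        (∑ i, ∑ j, v i * v j *
          ∏ l, g ((Pi.single i 1 + Pi.single j 1 : ι → ℕ) l) (b l)) / 2| ≤
      thirdOrderBound ι M * ‖v‖ ^ 3 := by
  have D := hasDerivAt_prod_line hg (ι := ι)
  have D0 : ∀ t, HasDerivAt (fun t => ∏ i, g 0 (b i + t * v i))
      (∑ i, v i * ∏ l, g ((Pi.single i 1 : ι → ℕ) l) (b l + t * v l)) t := fun t => by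
    simpa using D 0 b v t
  have D1 : ∀ t, HasDerivAt
      (fun t => ∑ i, v i * ∏ l, g ((Pi.single i 1 : ι → ℕ) l) (b l + t * v l))
      (∑ i, v i * ∑ j, v j *
        ∏ l, g ((Pi.single i 1 + Pi.single j 1 : ι → ℕ) l) (b l + t * v l)) t := fun t =>
    HasDerivAt.fun_sum fun i _ => (D _ b v t).const_mul (v i)
  have D2 : ∀ t, HasDerivAt
      (fun t => ∑ i, v i * ∑ j, v j *
        ∏ l, g ((Pi.single i 1 + Pi.single j 1 : ι → ℕ) l) (b l + t * v l))
      (∑ i, v i * ∑ j, v j * ∑ k, v k *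
        ∏ l, g ((Pi.single i 1 + Pi.single j 1 + Pi.single k 1 : ι → ℕ) l) (b l + t * v l)) t :=
    fun t => HasDerivAt.fun_sum fun i _ => (HasDerivAt.fun_sum fun j _ =>
      (D _ b v t).const_mul (v j)).const_mul (v i)
  have hv : ∀ i, |v i| ≤ ‖v‖ := fun i => norm_le_pi_norm v i
  have D3 : ∀ t, |∑ i, v i * ∑ j, v j * ∑ k, v k *
        ∏ l, g ((Pi.single i 1 + Pi.single j 1 + Pi.single k 1 : ι → ℕ) l) (b l + t * v l)| ≤
      thirdOrderBound ι M * ‖v‖ ^ 3 := by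
    intro t
    have key : ∀ {w : ι → ℝ} {c : ι → ℝ}, (∀ i, |w i| ≤ c i) →
        |∑ i, v i * w i| ≤ ‖v‖ * ∑ i, c i := by
      intro w c hw
      rw [Finset.mul_sum]
      refine (Finset.abs_sum_le_sum_abs _ _).trans (Finset.sum_le_sum fun i _ => ?_)
      rw [abs_mul]
      exact mul_le_mul (hv i) (hw i) (abs_nonneg _) (norm_nonneg _)
    refine (key fun i => key fun j => key
      (c := fun k => ∏ l, M ((Pi.single i 1 + Pi.single j 1 + Pi.single k 1 : ι → ℕ) l))
      fun k => ?_).trans (le_of_eq ?_)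
    · rw [Finset.abs_prod]
      exact Finset.prod_le_prod (fun _ _ => abs_nonneg _) fun l _ => hM _ _
    · simp only [thirdOrderBound, ← Finset.mul_sum]
      ring
  have T := abs_taylor_two_le D0 D1 D2 D3
  simpa [Finset.mul_sum, mul_assoc] using T

/-- Second order expansion of the expectation of a product function under a small centred
perturbation. -/
lemma abs_integral_prod_taylor_le {g : ℕ → ℝ → ℝ} {M : ℕ → ℝ}
    (hg : ∀ k x, HasDerivAt (g k) (g (k + 1) x) x) (hM : ∀ k x, |g k x| ≤ M k)
    {μ : Measure (ι → ℝ)} [IsProbabilityMeasure μ] (h3 : MemLp id 3 μ)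
    (h0 : ∀ i, ∫ x, x i ∂μ = 0) (b : ι → ℝ) {r : ℝ} (hr : 0 ≤ r) :
    |∫ x, ∏ i, g 0 (b i + r * x i) ∂μ - ∏ i, g 0 (b i) -
        r ^ 2 / 2 * ∑ i, ∑ j, (∫ x, x i * x j ∂μ) *
          ∏ l, g ((Pi.single i 1 + Pi.single j 1 : ι → ℕ) l) (b l)| ≤
      r ^ 3 * (thirdOrderBound ι M * ∫ x, ‖x‖ ^ 3 ∂μ) := by
  have hgc : ∀ k, Continuous (g k) := fun k =>
    continuous_iff_continuousAt.2 fun x => (hg k x).continuousAt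
  have hL : ∀ i, MemLp (fun x : ι → ℝ => x i) 3 μ := fun i => by
    refine h3.mono (measurable_pi_apply i).aestronglyMeasurable (Filter.Eventually.of_forall fun x => norm_le_pi_norm x i)
  have hL2 : ∀ i, MemLp (fun x : ι → ℝ => x i) 2 μ := fun i =>
    (hL i).mono_exponent (by norm_num)
  have i1 : ∀ i, Integrable (fun x : ι → ℝ => x i) μ := fun i =>
    (hL i).integrable (by norm_num)
  have i2 : ∀ i j, Integrable (fun x : ι → ℝ => x i * x j) μ := fun i j =>
    (hL2 i).integrable_mul (hL2 j)
  have i3 : Integrable (fun x : ι → ℝ => ‖x‖ ^ 3) μ := by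
    simpa using h3.integrable_norm_pow (by norm_num)
  have iF : Integrable (fun x : ι → ℝ => ∏ i, g 0 (b i + r * x i)) μ := by
    refine Integrable.of_bound (C := ∏ _i : ι, M 0) ?_ (Filter.Eventually.of_forall fun x => ?_)
    · exact (continuous_finsetProd _ fun i _ => (hgc 0).comp (by fun_prop)).aestronglyMeasurable
    · rw [Real.norm_eq_abs, Finset.abs_prod]
      exact Finset.prod_le_prod (fun _ _ => abs_nonneg _) fun l _ => hM _ _
  set c1 : ι → ℝ := fun i => ∏ l, g ((Pi.single i 1 : ι → ℕ) l) (b l)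
  set c2 : ι → ι → ℝ := fun i j => ∏ l, g ((Pi.single i 1 + Pi.single j 1 : ι → ℕ) l) (b l)
  have I1 : Integrable (fun x : ι → ℝ => ∑ i, (r * x i) * c1 i) μ :=
    integrable_finsetSum _ fun i _ => ((i1 i).const_mul r).mul_const _
  have I2 : Integrable (fun x : ι → ℝ => (∑ i, ∑ j, (r * x i) * (r * x j) * c2 i j) / 2) μ := by
    refine (integrable_finsetSum _ fun i _ => integrable_finsetSum _ fun j _ => ?_).div_const 2
    refine (((i2 i j).const_mul (r ^ 2)).mul_const (c2 i j)).congr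
      (Filter.Eventually.of_forall fun x => ?_)
    simp only
    ring
  have pt : ∀ x : ι → ℝ, |∏ i, g 0 (b i + r * x i) - ∏ i, g 0 (b i) -
      ∑ i, (r * x i) * c1 i - (∑ i, ∑ j, (r * x i) * (r * x j) * c2 i j) / 2| ≤
      r ^ 3 * (thirdOrderBound ι M * ‖x‖ ^ 3) := fun x => by
    have h := abs_prod_taylor_two_le hg hM b (r • x)
    rw [norm_smul, Real.norm_eq_abs, abs_of_nonneg hr] at h
    simp only [Pi.smul_apply, smul_eq_mul] at h
    exact h.trans (le_of_eq (by ring))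
  have J1 : ∫ x, ∑ i, (r * x i) * c1 i ∂μ = 0 := by
    rw [integral_finsetSum _ fun i _ => ((i1 i).const_mul r).mul_const _]
    refine Finset.sum_eq_zero fun i _ => ?_
    rw [integral_mul_const, integral_const_mul, h0 i]
    ring
  have J2 : ∫ x, (∑ i, ∑ j, (r * x i) * (r * x j) * c2 i j) / 2 ∂μ =
      r ^ 2 / 2 * ∑ i, ∑ j, (∫ x, x i * x j ∂μ) * c2 i j := by
    have hi : ∀ i j, Integrable (fun x : ι → ℝ => (r * x i) * (r * x j) * c2 i j) μ := by
      intro i j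
      refine (((i2 i j).const_mul (r ^ 2)).mul_const (c2 i j)).congr
        (Filter.Eventually.of_forall fun x => ?_)
      simp only
      ring
    rw [integral_div, integral_finsetSum _ fun i _ => integrable_finsetSum _ fun j _ => hi i j,
      Finset.mul_sum, Finset.sum_div]
    refine Finset.sum_congr rfl fun i _ => ?_
    rw [integral_finsetSum _ fun j _ => hi i j, Finset.mul_sum, Finset.sum_div]
    refine Finset.sum_congr rfl fun j _ => ?_
    have : ∀ x : ι → ℝ, (r * x i) * (r * x j) * c2 i j = r ^ 2 * c2 i j * (x i * x j) :=
      fun x => by ring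
    simp_rw [this, integral_const_mul]
    ring
  have e : ∫ x, (∏ i, g 0 (b i + r * x i) - ∏ i, g 0 (b i) -
      ∑ i, (r * x i) * c1 i - (∑ i, ∑ j, (r * x i) * (r * x j) * c2 i j) / 2) ∂μ =
      ∫ x, ∏ i, g 0 (b i + r * x i) ∂μ - ∏ i, g 0 (b i) -
        r ^ 2 / 2 * ∑ i, ∑ j, (∫ x, x i * x j ∂μ) * c2 i j := by
    have H1 : Integrable (fun x : ι → ℝ => ∏ i, g 0 (b i + r * x i) - ∏ i, g 0 (b i)) μ :=
      iF.sub (integrable_const _)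
    have H2 : Integrable (fun x : ι → ℝ => ∏ i, g 0 (b i + r * x i) - ∏ i, g 0 (b i) -
        ∑ i, (r * x i) * c1 i) μ := H1.sub I1
    rw [integral_sub H2 I2, integral_sub H1 I1, integral_sub iF (integrable_const _), J1, J2]
    simp
  rw [← e, ← integral_const_mul, ← integral_const_mul]
  refine abs_integral_le_integral_abs.trans (integral_mono_of_nonneg
    (Filter.Eventually.of_forall fun x => abs_nonneg _) ((i3.const_mul _).const_mul _)
    (Filter.Eventually.of_forall pt))

/-- One replacement step in Slepian's inequality, at a fixed base point. -/
lemma integral_prod_step_le {g : ℕ → ℝ → ℝ} {M : ℕ → ℝ}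
    (hg : ∀ k x, HasDerivAt (g k) (g (k + 1) x) x) (hM : ∀ k x, |g k x| ≤ M k)
    (hg0 : ∀ x, 0 ≤ g 0 x) (hg1 : ∀ x, g 1 x ≤ 0)
    {μ ν : Measure (ι → ℝ)} [IsProbabilityMeasure μ] [IsProbabilityMeasure ν]
    (hμ3 : MemLp id 3 μ) (hν3 : MemLp id 3 ν)
    (hμ0 : ∀ i, ∫ x, x i ∂μ = 0) (hν0 : ∀ i, ∫ x, x i ∂ν = 0)
    (hdiag : ∀ i, ∫ x, x i * x i ∂μ = ∫ x, x i * x i ∂ν)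
    (hoff : ∀ i j, i ≠ j → ∫ x, x i * x j ∂μ ≤ ∫ x, x i * x j ∂ν)
    (b : ι → ℝ) {r : ℝ} (hr : 0 ≤ r) :
    ∫ x, ∏ i, g 0 (b i + r * x i) ∂μ ≤ ∫ x, ∏ i, g 0 (b i + r * x i) ∂ν +
      r ^ 3 * (thirdOrderBound ι M * (∫ x, ‖x‖ ^ 3 ∂μ + ∫ x, ‖x‖ ^ 3 ∂ν)) := by
  have A := abs_le.1 (abs_integral_prod_taylor_le hg hM hμ3 hμ0 b hr)
  have B := abs_le.1 (abs_integral_prod_taylor_le hg hM hν3 hν0 b hr)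
  have C : ∑ i, ∑ j, (∫ x, x i * x j ∂μ) *
        ∏ l, g ((Pi.single i 1 + Pi.single j 1 : ι → ℕ) l) (b l) ≤
      ∑ i, ∑ j, (∫ x, x i * x j ∂ν) *
        ∏ l, g ((Pi.single i 1 + Pi.single j 1 : ι → ℕ) l) (b l) := by
    -- Diagonal terms agree whatever the sign of the second derivative. Off the diagonal the mixed
    -- derivative contains two factors `g 1 ≤ 0` and otherwise `g 0 ≥ 0`, hence is nonnegative.
    refine Finset.sum_le_sum fun i _ => Finset.sum_le_sum fun j _ => ?_
    obtain rfl | hij := eq_or_ne i j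
    · rw [hdiag]
    refine mul_le_mul_of_nonneg_right (hoff i j hij) ?_
    rw [← Finset.mul_prod_erase Finset.univ _ (Finset.mem_univ i),
      ← Finset.mul_prod_erase (Finset.univ.erase i) _
        (Finset.mem_erase.2 ⟨hij.symm, Finset.mem_univ j⟩), ← mul_assoc]
    refine mul_nonneg (mul_nonneg_of_nonpos_of_nonpos ?_ ?_) (Finset.prod_nonneg fun l hl => ?_)
    · simpa [Pi.single_eq_of_ne hij] using hg1 (b i)
    · simpa [Pi.single_eq_of_ne hij.symm] using hg1 (b j)
    · have h1 : l ≠ j := Finset.ne_of_mem_erase hl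
      have h2 : l ≠ i := Finset.ne_of_mem_erase (Finset.mem_of_mem_erase hl)
      simpa [Pi.single_eq_of_ne h1, Pi.single_eq_of_ne h2] using hg0 (b l)
  have D := mul_le_mul_of_nonneg_left C (by positivity : 0 ≤ r ^ 2 / 2)
  have E : r ^ 3 * (thirdOrderBound ι M * (∫ x, ‖x‖ ^ 3 ∂μ + ∫ x, ‖x‖ ^ 3 ∂ν)) =
    r ^ 3 * (thirdOrderBound ι M * ∫ x, ‖x‖ ^ 3 ∂μ) +
      r ^ 3 * (thirdOrderBound ι M * ∫ x, ‖x‖ ^ 3 ∂ν) := by ring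
  rw [E]
  linarith [A.2, B.1]

end ProductFunctions

/-! ### Convolution powers and Lindeberg replacement -/

section ConvolutionPowers

variable {E : Type*} [AddCommMonoid E] [MeasurableSpace E] [MeasurableAdd₂ E]

/-- The `k`-fold convolution power of a measure. -/
noncomputable def convPow (μ : Measure E) : ℕ → Measure E
  | 0 => Measure.dirac 0
  | k + 1 => (convPow μ k).conv μ

instance isProbabilityMeasure_convPow (μ : Measure E) [IsProbabilityMeasure μ] (k : ℕ) :
    IsProbabilityMeasure (convPow μ k) := by
  induction k with
  | zero => exact Measure.dirac.isProbabilityMeasure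
  | succ k ih => exact inferInstanceAs (IsProbabilityMeasure ((convPow μ k).conv μ))

/-- Lindeberg replacement: if replacing one summand costs at most `e`, replacing `k` of them costs
at most `k * e`. -/
lemma integral_conv_convPow_le {F : E → ℝ} {K e : ℝ} (hF : Measurable F) (hK : ∀ x, |F x| ≤ K)
    {μ ν : Measure E} [IsProbabilityMeasure μ] [IsProbabilityMeasure ν]
    (hstep : ∀ b, ∫ x, F (b + x) ∂μ ≤ ∫ x, F (b + x) ∂ν + e) (k : ℕ) :
    ∀ (β : Measure E) [IsProbabilityMeasure β],
      ∫ x, F x ∂(β.conv (convPow μ k)) ≤ ∫ x, F x ∂(β.conv (convPow ν k)) + k * e := by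
  have hint : ∀ (κ : Measure E) [IsProbabilityMeasure κ], Integrable F κ := fun κ _ =>
    Integrable.of_bound hF.aestronglyMeasurable K (Filter.Eventually.of_forall hK)
  induction k with
  | zero => intro β _; simp [convPow]
  | succ k ih =>
    intro β _
    have h1 : ∫ x, F x ∂(β.conv (convPow μ (k + 1))) ≤
        ∫ x, F x ∂((β.conv (convPow μ k)).conv ν) + e := by
      rw [convPow, ← Measure.conv_assoc, integral_conv (hint _), integral_conv (hint _)]
      have hi : ∀ (κ : Measure E) [IsProbabilityMeasure κ], Integrable
          (fun b => ∫ x, F (b + x) ∂κ) (β.conv (convPow μ k)) := by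
        intro κ _
        have h := (hint ((β.conv (convPow μ k)).conv κ))
        exact ((integrable_map_measure hF.aestronglyMeasurable
          measurable_add.aemeasurable).1 h).integral_prod_left
      refine (integral_mono (hi μ) ((hi ν).add (integrable_const e)) hstep).trans (le_of_eq ?_)
      rw [integral_add' (hi ν) (integrable_const e)]
      simp
    -- The summand already replaced is absorbed into the base measure by commutativity, which is why
    -- the induction is over all `β`.
    have h2 := ih (β.conv ν)
    have e1 : (β.conv (convPow μ k)).conv ν = (β.conv ν).conv (convPow μ k) := by
      rw [Measure.conv_assoc, Measure.conv_comm (convPow μ k), ← Measure.conv_assoc]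
    have e2 : (β.conv ν).conv (convPow ν k) = β.conv (convPow ν (k + 1)) := by
      rw [Measure.conv_assoc, Measure.conv_comm ν, convPow]
    rw [e1] at h1
    rw [e2] at h2
    push_cast
    linarith

end ConvolutionPowers

/-- A centred Gaussian measure is the `m`-fold convolution power of its rescaling by `1 / √m`. -/
lemma convPow_map_smul_eq {E : Type*} [NormedAddCommGroup E] [NormedSpace ℝ E]
    [MeasurableSpace E] [BorelSpace E] [CompleteSpace E] [SecondCountableTopology E]
    (μ : Measure E) [IsGaussian μ] (h0 : μ[id] = 0) {m : ℕ} (hm : m ≠ 0) :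
    convPow (μ.map (ContinuousLinearMap.lsmul ℝ ℝ (√(m : ℝ))⁻¹ : E →L[ℝ] E)) m = μ := by
  set T : E →L[ℝ] E := ContinuousLinearMap.lsmul ℝ ℝ (√(m : ℝ))⁻¹
  have hp : ∀ (κ : Measure E) [IsProbabilityMeasure κ] (L : StrongDual ℝ E) (k : ℕ),
      charFunDual (convPow κ k) L = charFunDual κ L ^ k := by
    intro κ _ L k
    induction k with
    | zero => simp [convPow]
    | succ k ih => rw [convPow, charFunDual_conv, ih, pow_succ]
  -- Scaling by `1 / √m` divides each variance by `m`; the `m`-th power of the characteristic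
  -- function restores it.
  refine Measure.ext_of_charFunDual (funext fun L => ?_)
  have hL : L ∘L T = (√(m : ℝ))⁻¹ • L := by
    ext x
    simp [T]
  rw [hp, charFunDual_map, hL, IsGaussian.charFunDual_eq_of_integral_eq_zero h0,
    IsGaussian.charFunDual_eq_of_integral_eq_zero h0, ← Complex.exp_nat_mul]
  congr 1
  have hv : Var[⇑((√(m : ℝ))⁻¹ • L); μ] = (m : ℝ)⁻¹ * Var[L; μ] := by
    rw [FunLike.coe_smul, variance_smul, inv_pow, Real.sq_sqrt (by positivity)]
  have hm' : (m : ℂ) ≠ 0 := by exact_mod_cast hm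
  rw [hv]
  push_cast
  field_simp

/-! ### Slepian's inequality -/

section Slepian

variable {ι : Type*} [Fintype ι]

/-- Slepian's inequality for expectations of products of nonincreasing smooth functions. -/
lemma integral_prod_le_of_covariance_le {g : ℕ → ℝ → ℝ} {M : ℕ → ℝ}
    (hg : ∀ k x, HasDerivAt (g k) (g (k + 1) x) x) (hM : ∀ k x, |g k x| ≤ M k)
    (hg0 : ∀ x, 0 ≤ g 0 x) (hg1 : ∀ x, g 1 x ≤ 0)
    {μ ν : Measure (ι → ℝ)} [IsGaussian μ] [IsGaussian ν]
    (hμ0 : ∀ i, ∫ x, x i ∂μ = 0) (hν0 : ∀ i, ∫ x, x i ∂ν = 0)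
    (hdiag : ∀ i, ∫ x, x i * x i ∂μ = ∫ x, x i * x i ∂ν)
    (hoff : ∀ i j, i ≠ j → ∫ x, x i * x j ∂μ ≤ ∫ x, x i * x j ∂ν) :
    ∫ x, ∏ i, g 0 (x i) ∂μ ≤ ∫ x, ∏ i, g 0 (x i) ∂ν := by
  classical
  have hgc : Continuous (g 0) := continuous_iff_continuousAt.2 fun x => (hg 0 x).continuousAt
  have hFc : Continuous fun x : ι → ℝ => ∏ i, g 0 (x i) :=
    continuous_finsetProd _ fun i _ => hgc.comp (by fun_prop)
  have hFb : ∀ x : ι → ℝ, |∏ i, g 0 (x i)| ≤ ∏ _i : ι, M 0 := fun x => by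
    rw [Finset.abs_prod]
    exact Finset.prod_le_prod (fun _ _ => abs_nonneg _) fun l _ => hM _ _
  have centred : ∀ (κ : Measure (ι → ℝ)) [IsGaussian κ], (∀ i, ∫ x, x i ∂κ = 0) →
      κ[id] = 0 := by
    intro κ _ h
    ext i
    rw [← ContinuousLinearMap.proj_apply (R := ℝ) (φ := fun _ : ι => ℝ) i (κ[id]),
      ← ContinuousLinearMap.integral_comp_comm _ IsGaussian.integrable_id]
    simpa using h i
  set K : ℝ := thirdOrderBound ι M * (∫ x, ‖x‖ ^ 3 ∂μ + ∫ x, ‖x‖ ^ 3 ∂ν)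
  -- There are `m` replacements, each costing `r ^ 3 * K` with `r = 1 / √m`, for a total of `K /
  -- √m`.
  have bound : ∀ m : ℕ, m ≠ 0 →
      ∫ x, ∏ i, g 0 (x i) ∂μ ≤ ∫ x, ∏ i, g 0 (x i) ∂ν + (√(m : ℝ))⁻¹ * K := by
    intro m hm
    set r : ℝ := (√(m : ℝ))⁻¹ with hr
    have hr0 : 0 ≤ r := by positivity
    have hmap : ∀ (κ : Measure (ι → ℝ)) (b : ι → ℝ),
        ∫ x, ∏ i, g 0 ((b + x) i) ∂(κ.map (ContinuousLinearMap.lsmul ℝ ℝ r)) =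
          ∫ x, ∏ i, g 0 (b i + r * x i) ∂κ := by
      intro κ b
      have hc : Continuous fun x : ι → ℝ => ∏ i, g 0 ((b + x) i) :=
        hFc.comp (continuous_const.add continuous_id)
      rw [integral_map (ContinuousLinearMap.continuous _).measurable.aemeasurable
        hc.aestronglyMeasurable]
      simp
    have key := integral_conv_convPow_le hFc.measurable hFb
      (μ := μ.map (ContinuousLinearMap.lsmul ℝ ℝ r))
      (ν := ν.map (ContinuousLinearMap.lsmul ℝ ℝ r)) (e := r ^ 3 * K)
      (fun b => by
        rw [hmap, hmap]
        exact integral_prod_step_le hg hM hg0 hg1 (IsGaussian.memLp_id μ 3 (by norm_num))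
          (IsGaussian.memLp_id ν 3 (by norm_num)) hμ0 hν0 hdiag hoff b hr0) m (Measure.dirac 0)
    rw [hr, convPow_map_smul_eq μ (centred μ hμ0) hm, convPow_map_smul_eq ν (centred ν hν0) hm,
      ← hr, Measure.dirac_zero_conv, Measure.dirac_zero_conv] at key
    have hmr : (m : ℝ) * r ^ 2 = 1 := by
      rw [hr, inv_pow, Real.sq_sqrt (by positivity)]
      exact mul_inv_cancel₀ (by exact_mod_cast hm)
    calc _ ≤ _ := key
      _ = _ := by linear_combination r * K * hmr
  have lim : Filter.Tendsto (fun m : ℕ => ∫ x, ∏ i, g 0 (x i) ∂ν + (√(m : ℝ))⁻¹ * K)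
      Filter.atTop (nhds (∫ x, ∏ i, g 0 (x i) ∂ν + 0 * K)) :=
    ((Real.tendsto_sqrt_atTop.comp tendsto_natCast_atTop_atTop).inv_tendsto_atTop.mul_const
      K).const_add _
  rw [zero_mul, add_zero] at lim
  exact ge_of_tendsto lim ((Filter.eventually_ne_atTop 0).mono bound)

/-- A smooth nonincreasing cutoff from `1` on `(-∞, u]` to `0` on `[u + ε, ∞)`. -/
noncomputable def smoothCutoff (u ε x : ℝ) : ℝ := 1 - Real.smoothTransition ((x - u) / ε)

lemma contDiff_smoothCutoff (u ε : ℝ) : ContDiff ℝ (⊤ : ℕ∞) (smoothCutoff u ε) :=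
  contDiff_const.sub (Real.smoothTransition.contDiff.comp (by fun_prop))

lemma antitone_smoothCutoff (u : ℝ) {ε : ℝ} (hε : 0 < ε) : Antitone (smoothCutoff u ε) := by
  intro x y hxy
  have := Real.smoothTransition.monotone
    (div_le_div_of_nonneg_right (sub_le_sub_right hxy u) hε.le)
  simp only [smoothCutoff]
  linarith

lemma smoothCutoff_of_le {u ε x : ℝ} (hε : 0 < ε) (hx : x ≤ u) : smoothCutoff u ε x = 1 := by
  rw [smoothCutoff, Real.smoothTransition.zero_of_nonpos
    (div_nonpos_of_nonpos_of_nonneg (by linarith) hε.le), sub_zero]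

lemma smoothCutoff_of_ge {u ε x : ℝ} (hε : 0 < ε) (hx : u + ε ≤ x) : smoothCutoff u ε x = 0 := by
  rw [smoothCutoff, Real.smoothTransition.one_of_one_le ((one_le_div hε).2 (by linarith)), sub_self]

/-- Each derivative is continuous on the compact transition interval, and the cutoff is locally
constant outside it. The `1` in the maximum covers order zero. -/
lemma exists_abs_iteratedDeriv_smoothCutoff_le (u : ℝ) {ε : ℝ} (hε : 0 < ε) (k : ℕ) :
    ∃ M, ∀ x, |iteratedDeriv k (smoothCutoff u ε) x| ≤ M := by
  have hc : Continuous (iteratedDeriv k (smoothCutoff u ε)) :=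
    (contDiff_smoothCutoff u ε).continuous_iteratedDeriv k (by exact_mod_cast le_top)
  obtain ⟨M, hM⟩ := isCompact_Icc.exists_bound_of_continuousOn (s := Set.Icc u (u + ε))
    hc.continuousOn
  have hconst : ∀ c x : ℝ, |iteratedDeriv k (fun _ : ℝ => c) x| ≤ |c| := by
    intro c x
    rw [iteratedDeriv_const]
    split_ifs <;> simp
  refine ⟨max M 1, fun x => ?_⟩
  by_cases hx : x ∈ Set.Icc u (u + ε)
  · exact (hM x hx).trans (le_max_left _ _)
  refine le_trans ?_ (le_max_right _ _)
  rcases lt_or_ge x u with h | h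
  · have : smoothCutoff u ε =ᶠ[nhds x] fun _ => 1 :=
      (eventually_lt_nhds h).mono fun y hy => smoothCutoff_of_le hε hy.le
    rw [this.iteratedDeriv_eq]
    simpa using hconst 1 x
  · have h' : u + ε < x := not_le.1 fun h' => hx ⟨h, h'⟩
    have : smoothCutoff u ε =ᶠ[nhds x] fun _ => 0 :=
      (eventually_gt_nhds h').mono fun y hy => smoothCutoff_of_ge hε (le_of_lt hy)
    rw [this.iteratedDeriv_eq]
    simp

/-- **Slepian's inequality** for centred Gaussian measures on `ι → ℝ`. -/
theorem slepian {μ ν : Measure (ι → ℝ)} [IsGaussian μ] [IsGaussian ν]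
    (hμ0 : ∀ i, ∫ x, x i ∂μ = 0) (hν0 : ∀ i, ∫ x, x i ∂ν = 0)
    (hdiag : ∀ i, ∫ x, x i * x i ∂μ = ∫ x, x i * x i ∂ν)
    (hoff : ∀ i j, i ≠ j → ∫ x, x i * x j ∂μ ≤ ∫ x, x i * x j ∂ν) (u : ℝ) :
    μ.real {x | ∀ i, x i ≤ u} ≤ ν.real {x | ∀ i, x i ≤ u} := by
  have hms : ∀ v : ℝ, MeasurableSet {x : ι → ℝ | ∀ i, x i ≤ v} := fun v => by
    rw [Set.ofPred_forall]
    exact MeasurableSet.iInter fun i => measurableSet_le (measurable_pi_apply i) measurable_const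
  -- The product of cutoffs lies between the indicators of the orthants at `u` and `u + ε`.
  have approx : ∀ ε : ℝ, 0 < ε → μ.real {x | ∀ i, x i ≤ u} ≤ ν.real {x | ∀ i, x i ≤ u + ε} := by
    intro ε hε
    choose M hM using exists_abs_iteratedDeriv_smoothCutoff_le u hε
    have hsm := contDiff_smoothCutoff u ε
    have h0 : ∀ x, 0 ≤ smoothCutoff u ε x := fun x =>
      sub_nonneg.2 (Real.smoothTransition.le_one _)
    have h1 : ∀ x, smoothCutoff u ε x ≤ 1 := fun x =>
      sub_le_self _ (Real.smoothTransition.nonneg _)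
    have key := integral_prod_le_of_covariance_le (μ := μ) (ν := ν)
      (g := fun k => iteratedDeriv k (smoothCutoff u ε))
      (M := M) (fun k x => by
        rw [iteratedDeriv_succ]
        exact (hsm.differentiable_iteratedDeriv k
          (by exact_mod_cast WithTop.coe_lt_top k)).differentiableAt.hasDerivAt) hM
      (fun x => by simpa using h0 x)
      (fun x => by
        rw [iteratedDeriv_one]
        exact (antitone_smoothCutoff u hε).deriv_nonpos) hμ0 hν0 hdiag hoff
    simp only [iteratedDeriv_zero] at key
    have hint : ∀ (κ : Measure (ι → ℝ)) [IsGaussian κ],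
        Integrable (fun x : ι → ℝ => ∏ i, smoothCutoff u ε (x i)) κ := fun κ _ => by
      refine Integrable.of_bound (C := 1) ?_ (Filter.Eventually.of_forall fun x => ?_)
      · exact (continuous_finsetProd _ fun i _ =>
          hsm.continuous.comp (by fun_prop)).aestronglyMeasurable
      · rw [Real.norm_eq_abs, abs_of_nonneg (Finset.prod_nonneg fun i _ => h0 _)]
        exact Finset.prod_le_one (fun i _ => h0 _) fun i _ => h1 _
    have lower : μ.real {x | ∀ i, x i ≤ u} ≤ ∫ x, ∏ i, smoothCutoff u ε (x i) ∂μ := by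
      rw [← integral_indicator_one (hms u)]
      refine integral_mono ((integrable_const (1 : ℝ)).indicator (hms u)) (hint μ) fun x => ?_
      by_cases hx : x ∈ {x : ι → ℝ | ∀ i, x i ≤ u}
      · rw [Set.indicator_of_mem hx, Finset.prod_congr rfl fun i _ =>
          smoothCutoff_of_le hε (hx i)]
        simp
      · rw [Set.indicator_of_notMem hx]
        exact Finset.prod_nonneg fun i _ => h0 _
    have upper : ∫ x, ∏ i, smoothCutoff u ε (x i) ∂ν ≤ ν.real {x | ∀ i, x i ≤ u + ε} := by
      rw [← integral_indicator_one (hms (u + ε))]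
      refine integral_mono (hint ν) ((integrable_const (1 : ℝ)).indicator (hms _)) fun x => ?_
      by_cases hx : x ∈ {x : ι → ℝ | ∀ i, x i ≤ u + ε}
      · rw [Set.indicator_of_mem hx]
        exact Finset.prod_le_one (fun i _ => h0 _) fun i _ => h1 _
      · rw [Set.indicator_of_notMem hx]
        simp only [Set.mem_ofPred_eq, not_forall, not_le] at hx
        obtain ⟨i, hi⟩ := hx
        exact (Finset.prod_eq_zero (Finset.mem_univ i) (smoothCutoff_of_ge hε hi.le)).le
    exact lower.trans (key.trans upper)
  -- The loss `ε` is removed by continuity of `ν` from above.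
  have hset : (⋂ k : ℕ, {x : ι → ℝ | ∀ i, x i ≤ u + 1 / ((k : ℝ) + 1)}) =
      {x | ∀ i, x i ≤ u} := by
    ext x
    simp only [Set.mem_iInter, Set.mem_ofPred_eq]
    refine ⟨fun h i => ?_, fun h k i => (h i).trans (by simp; positivity)⟩
    have lim := (tendsto_one_div_add_atTop_nhds_zero_nat (𝕜 := ℝ)).const_add u
    rw [add_zero] at lim
    exact ge_of_tendsto' lim fun k => h k i
  have lim : Filter.Tendsto
      (fun k : ℕ => ν {x : ι → ℝ | ∀ i, x i ≤ u + 1 / ((k : ℝ) + 1)}) Filter.atTop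
      (nhds (ν {x | ∀ i, x i ≤ u})) := by
    rw [← hset]
    refine tendsto_measure_iInter_atTop (fun k => (hms _).nullMeasurableSet) ?_
      ⟨0, measure_ne_top _ _⟩
    intro k l hkl x hx i
    exact (hx i).trans (add_le_add_right (one_div_le_one_div_of_le (by positivity)
      (by exact_mod_cast Nat.succ_le_succ hkl)) u)
  exact ge_of_tendsto' ((ENNReal.tendsto_toReal (measure_ne_top _ _)).comp lim)
    fun k => approx _ (by positivity)

end Slepian

/-! ### Normal tails and the one-dimensional integral -/

/-- The distribution function of the standard normal law. -/
noncomputable def stdNormalCDF (t : ℝ) : ℝ := (gaussianReal 0 1).real (Set.Iic t)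

/-- A constant for elementary lower bounds on the upper tail of the normal law. -/
noncomputable def tailConst : ℝ := (√(2 * Real.pi))⁻¹ * Real.exp (-(3 / 2))

lemma tailConst_pos : 0 < tailConst := by
  unfold tailConst
  positivity

lemma stdNormalCDF_nonneg (t : ℝ) : 0 ≤ stdNormalCDF t := measureReal_nonneg

lemma stdNormalCDF_le_one (t : ℝ) : stdNormalCDF t ≤ 1 := measureReal_le_one

lemma monotone_stdNormalCDF : Monotone stdNormalCDF := fun _ _ h =>
  measureReal_mono (Set.Iic_subset_Iic.2 h)

lemma stdNormalCDF_le_one_sub {t : ℝ} (ht : 0 ≤ t) :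
    stdNormalCDF t ≤ 1 - tailConst * Real.exp (-(t ^ 2 / 2)) / (1 + t) := by
  have h1 : (0 : ℝ) < 1 + t := by linarith
  -- On `(t, t + d]` one has `x ^ 2 ≤ t ^ 2 + 2 * t * d + d ^ 2 ≤ t ^ 2 + 3`, so the density loses
  -- at most the factor `exp (-3/2)` in `tailConst`; the width `d` supplies `1 / (1 + t)`.
  set d : ℝ := 1 / (1 + t)
  have hd : 0 < d := by positivity
  have hd1 : d ≤ 1 := (div_le_one h1).2 (by linarith)
  have htd : t * d ≤ 1 := by
    rw [mul_one_div, div_le_one h1]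
    linarith
  have hlow : tailConst * Real.exp (-(t ^ 2 / 2)) / (1 + t) ≤
      (gaussianReal 0 1).real (Set.Ioc t (t + d)) := by
    have hpdf : ∀ x ∈ Set.Ioc t (t + d),
        tailConst * Real.exp (-(t ^ 2 / 2)) ≤ gaussianPDFReal 0 1 x := by
      intro x hx
      rw [tailConst, gaussianPDFReal, mul_assoc, ← Real.exp_add]
      simp only [NNReal.coe_one, mul_one, sub_zero]
      refine mul_le_mul_of_nonneg_left (Real.exp_le_exp.2 ?_) (by positivity)
      nlinarith [hx.1, hx.2, mul_nonneg (ht.trans hx.1.le) (sub_nonneg.2 hx.2)]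
    rw [measureReal_def, gaussianReal_apply_eq_integral 0 one_ne_zero, ENNReal.toReal_ofReal
      (integral_nonneg fun x => gaussianPDFReal_nonneg 0 1 x)]
    have := setIntegral_mono_on (μ := volume) (s := Set.Ioc t (t + d))
      (integrableOn_const (C := tailConst * Real.exp (-(t ^ 2 / 2))) (by simp))
      (integrable_gaussianPDFReal 0 1).integrableOn measurableSet_Ioc hpdf
    refine le_trans (le_of_eq ?_) this
    rw [setIntegral_const, Real.volume_real_Ioc_of_le (by linarith), add_sub_cancel_left,
      smul_eq_mul, div_eq_inv_mul, ← one_div]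
  have hdisj : stdNormalCDF t + (gaussianReal 0 1).real (Set.Ioc t (t + d)) ≤ 1 := by
    have hd : Disjoint (Set.Iic t) (Set.Ioc t (t + d)) :=
      Set.disjoint_left.2 fun x hx hx' => absurd hx'.1 (not_lt.2 hx)
    rw [stdNormalCDF, ← measureReal_union hd measurableSet_Ioc]
    exact measureReal_le_one
  linarith

lemma integral_exp_neg_mul_abs_sub {w : ℝ} (hw : 0 < w) (m : ℝ) :
    ∫ x : ℝ, Real.exp (-(w * |x - m|)) = 2 / w := by
  rw [integral_sub_right_eq_self (fun x : ℝ => Real.exp (-(w * |x|))) m,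
    integral_comp_abs (f := fun x : ℝ => Real.exp (-(w * x)))]
  have := integral_exp_mul_Ioi (neg_lt_zero.2 hw) 0
  simp only [neg_mul, mul_zero, Real.exp_zero] at this
  rw [this]
  field_simp

/-- An upper tail estimate: the normal law integrates a function concentrated to the right of `w`
to order `exp (-w ^ 2 / 2) / w`. -/
lemma integral_gaussianReal_le {h : ℝ → ℝ} {w A B : ℝ} (hw : 0 < w) (hB : 0 ≤ B)
    (h0 : ∀ x, 0 ≤ h x) (hle : ∀ x, h x ≤ A + B * Real.exp (-(2 * w * max (w - x) 0))) :
    ∫ x, h x ∂(gaussianReal 0 1) ≤ A + B * (2 / w * Real.exp (-(w ^ 2 / 2))) := by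
  have hI := integral_exp_neg_mul_abs_sub hw w
  -- A nonintegrable function would have integral `0` by convention, against the value `2 / w`.
  have hint : Integrable fun x : ℝ => Real.exp (-(w * |x - w|)) := by
    by_contra hc
    rw [integral_undef hc] at hI
    exact absurd hI (by positivity)
  rw [integral_gaussianReal_eq_integral_smul one_ne_zero]
  have hpt : ∀ x, gaussianPDFReal 0 1 x • h x ≤ A * gaussianPDFReal 0 1 x +
      B * Real.exp (-(w ^ 2 / 2)) * Real.exp (-(w * |x - w|)) := by
    intro x
    have hp : gaussianPDFReal 0 1 x ≤ Real.exp (-(x ^ 2 / 2)) := by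
      rw [gaussianPDFReal]
      simp only [NNReal.coe_one, mul_one, sub_zero]
      rw [neg_div]
      refine mul_le_of_le_one_left (Real.exp_pos _).le (inv_le_one_of_one_le₀ ?_)
      rw [Real.one_le_sqrt]
      linarith [Real.pi_gt_three]
    -- Both cases amount to `(x - w) ^ 2 ≥ 0`. Right of `w` the density decays at rate at least `w`;
    -- left of `w` the rate `2 * w` outweighs its growth and leaves decay at rate `w`.
    have he : gaussianPDFReal 0 1 x * Real.exp (-(2 * w * max (w - x) 0)) ≤
        Real.exp (-(w ^ 2 / 2)) * Real.exp (-(w * |x - w|)) := by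
      refine (mul_le_mul_of_nonneg_right hp (Real.exp_pos _).le).trans ?_
      rw [← Real.exp_add, ← Real.exp_add, Real.exp_le_exp]
      rcases le_total x w with hx | hx
      · rw [max_eq_left (by linarith), abs_of_nonpos (by linarith)]
        nlinarith [sq_nonneg (x - w)]
      · rw [max_eq_right (by linarith), abs_of_nonneg (by linarith)]
        nlinarith [sq_nonneg (x - w)]
    calc gaussianPDFReal 0 1 x • h x
        ≤ gaussianPDFReal 0 1 x * (A + B * Real.exp (-(2 * w * max (w - x) 0))) :=
          mul_le_mul_of_nonneg_left (hle x) (gaussianPDFReal_nonneg 0 1 x)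
      _ = A * gaussianPDFReal 0 1 x +
          B * (gaussianPDFReal 0 1 x * Real.exp (-(2 * w * max (w - x) 0))) := by ring
      _ ≤ _ := by
          rw [mul_assoc B]
          gcongr
  have hi1 : Integrable fun x => A * gaussianPDFReal 0 1 x :=
    (integrable_gaussianPDFReal 0 1).const_mul A
  have hi2 : Integrable fun x : ℝ =>
      B * Real.exp (-(w ^ 2 / 2)) * Real.exp (-(w * |x - w|)) := hint.const_mul _
  refine (integral_mono_of_nonneg (Filter.Eventually.of_forall fun x =>
    mul_nonneg (gaussianPDFReal_nonneg 0 1 x) (h0 x)) (hi1.add hi2)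
    (Filter.Eventually.of_forall hpt)).trans (le_of_eq ?_)
  rw [integral_add' hi1 hi2, integral_const_mul, integral_const_mul, hI,
    integral_gaussianPDFReal_eq_one 0 one_ne_zero]
  ring

lemma exp_neg_le_factorial_div_pow {y : ℝ} (hy : 0 < y) (p : ℕ) :
    Real.exp (-y) ≤ p.factorial / y ^ p := by
  have h := Real.pow_div_factorial_le_exp y hy.le p
  rw [Real.exp_neg, inv_le_comm₀ (Real.exp_pos _) (by positivity), inv_div]
  exact h

lemma stdNormalCDF_pow_le_exp {t q : ℝ} (h : stdNormalCDF t ≤ 1 - q) (n : ℕ) :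
    stdNormalCDF t ^ n ≤ Real.exp (-(n * q)) := by
  calc stdNormalCDF t ^ n ≤ Real.exp (-q) ^ n :=
        pow_le_pow_left₀ (stdNormalCDF_nonneg t) (h.trans (Real.one_sub_le_exp_neg q)) n
    _ = Real.exp (-(n * q)) := by rw [← Real.exp_nat_mul]; ring_nf

/-- The expected number of exceedances of a level below the threshold `s - log L / (2 s)`,
`s = √(2 L)`, grows exponentially in the distance to the threshold. -/
lemma exp_le_mul_tail {L s a t : ℝ} (hL : 1 ≤ L) (hs : s = √(2 * L))
    (ha : a = s - Real.log L / (2 * s)) (has : s / 2 ≤ a) (ht : 0 ≤ t) (hta : t ≤ a) :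
    tailConst * Real.exp (-(1 / 4)) / 3 * Real.exp (s * (a - t) / 4) ≤
      Real.exp L * (tailConst * Real.exp (-(t ^ 2 / 2)) / (1 + t)) := by
  have hL0 : 0 < L := by linarith
  have hs2 : s ^ 2 = 2 * L := by rw [hs, Real.sq_sqrt (by linarith)]
  have hs0 : 0 < s := by rw [hs]; positivity
  have hl0 : 0 ≤ Real.log L := Real.log_nonneg hL
  have hsqrt : √L = Real.exp (Real.log L / 2) := by
    rw [← Real.log_sqrt hL0.le, Real.exp_log (Real.sqrt_pos.2 hL0)]
  have hl2 : Real.log L ^ 2 ≤ 4 * L := by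
    have h1 : Real.log L ≤ 2 * √L := by
      have := Real.log_le_sub_one_of_pos (Real.sqrt_pos.2 hL0)
      rw [Real.log_sqrt hL0.le] at this
      linarith
    calc Real.log L ^ 2 ≤ (2 * √L) ^ 2 := pow_le_pow_left₀ hl0 h1 2
      _ = 4 * L := by rw [mul_pow, Real.sq_sqrt hL0.le]; norm_num
  -- Squaring gives `a ^ 2 / 2 = L - log L / 2 + (log L) ^ 2 / (16 * L)`, and the last term is at
  -- most `1 / 4`. The surplus `log L / 2` pays for the factor `1 + t ≤ 3 * √L` below.
  have ha2 : a ^ 2 / 2 ≤ L - Real.log L / 2 + 1 / 4 := by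
    have e : a ^ 2 = 2 * L - Real.log L + Real.log L ^ 2 / (8 * L) := by
      have : a ^ 2 = s ^ 2 - Real.log L + Real.log L ^ 2 / (4 * s ^ 2) := by
        rw [ha]
        field_simp
        ring
      rw [this, hs2]
      ring_nf
    have : Real.log L ^ 2 / (8 * L) ≤ 1 / 2 := by
      rw [div_le_iff₀ (by linarith)]
      linarith
    linarith
  -- Since `a + t ≥ s / 2`, the difference `(a ^ 2 - t ^ 2) / 2` is at least `s * (a - t) / 4`.
  have hexp : s * (a - t) / 4 + Real.log L / 2 - 1 / 4 ≤ L - t ^ 2 / 2 := by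
    nlinarith [mul_nonneg ht (sub_nonneg.2 hta),
      mul_nonneg (sub_nonneg.2 hta) (sub_nonneg.2 has)]
  have hts : 1 + t ≤ 3 * Real.exp (Real.log L / 2) := by
    rw [← hsqrt]
    have h1 : 1 ≤ √L := Real.one_le_sqrt.2 hL
    have h2 : s ≤ 2 * √L := by
      rw [hs, Real.sqrt_le_left (by positivity), mul_pow, Real.sq_sqrt hL0.le]
      linarith
    have h3 : a ≤ s := by
      rw [ha]
      have : 0 ≤ Real.log L / (2 * s) := by positivity
      linarith
    linarith
  have hT := tailConst_pos
  rw [← mul_div_assoc, le_div_iff₀ (by linarith)]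
  calc tailConst * Real.exp (-(1 / 4)) / 3 * Real.exp (s * (a - t) / 4) * (1 + t)
      ≤ tailConst * Real.exp (-(1 / 4)) / 3 * Real.exp (s * (a - t) / 4) *
          (3 * Real.exp (Real.log L / 2)) := by gcongr
    _ = tailConst * Real.exp (s * (a - t) / 4 + Real.log L / 2 - 1 / 4) := by
        rw [show s * (a - t) / 4 + Real.log L / 2 - 1 / 4 =
          s * (a - t) / 4 + (Real.log L / 2 + -(1 / 4)) by ring, Real.exp_add, Real.exp_add]
        ring
    _ ≤ tailConst * Real.exp (L - t ^ 2 / 2) := by gcongr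
    _ = Real.exp L * (tailConst * Real.exp (-(t ^ 2 / 2))) := by
        rw [sub_eq_add_neg, Real.exp_add]
        ring

-- The integrand is of order one only where its argument exceeds the threshold `a`, that is for `x ≥
-- w = (a - δ * s) / c`; to the left of `w` it decays fast enough for `integral_gaussianReal_le`.
-- The condition on `log (log n)` keeps `c * w ≥ (1 - δ) * s / 2`. The term `exp (-(n * tailConst))`
-- accounts for negative arguments.
set_option maxHeartbeats 800000 in
lemma integral_stdNormalCDF_pow_le {δ c : ℝ} (hδ : δ ∈ Set.Ioo (0 : ℝ) 1) (hc : 0 < c) :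
    ∃ K : ℝ, 0 < K ∧ ∀ n : ℕ, 1 ≤ Real.log n →
      Real.log (Real.log n) ≤ 2 * (1 - δ) * Real.log n →
      ∫ x, stdNormalCDF (δ * √(2 * Real.log n) + c * x) ^ n ∂(gaussianReal 0 1) ≤
        Real.exp (-(n * tailConst)) + K * ((n : ℝ) ^ (-((1 - δ) ^ 2 / c ^ 2)) *
          Real.log n ^ (((1 - δ) / c ^ 2 - 1) / 2)) := by
  obtain ⟨hδ0, hδ1⟩ := hδ
  have hT := tailConst_pos
  -- Bounding `exp (-(k * y))` by a multiple of `y ^ (-p)` gives decay at rate `p * s * c / 4` in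
  -- `x`. This must be at least `2 * w`, and `c * w ≤ (1 - δ) * s`.
  obtain ⟨p, hp⟩ := exists_nat_ge (8 * (1 - δ) / c ^ 2)
  set k : ℝ := tailConst * Real.exp (-(1 / 4)) / 3 with hk
  have hk0 : 0 < k := by positivity
  set K : ℝ := 1 + p.factorial / k ^ p with hK
  have hK1 : 1 ≤ K := by
    have : 0 ≤ p.factorial / k ^ p := by positivity
    linarith
  have hd0 : 0 < 1 - δ := by linarith
  refine ⟨K * (4 * c / (1 - δ)), by positivity, fun n hL hlL => ?_⟩
  have hn0 : (0 : ℝ) < n := by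
    by_contra h
    have : n = 0 := by
      have := not_lt.1 h
      exact_mod_cast le_antisymm this (Nat.cast_nonneg n)
    simp [this] at hL
    linarith
  set L : ℝ := Real.log n with hLdef
  have hL0 : 0 < L := by linarith
  have hexpL : Real.exp L = n := Real.exp_log hn0
  set ℓ : ℝ := Real.log L with hℓ
  have hℓ0 : 0 ≤ ℓ := Real.log_nonneg hL
  set s : ℝ := √(2 * L) with hs
  have hs2 : s ^ 2 = 2 * L := Real.sq_sqrt (by linarith)
  have hs0 : 0 < s := by positivity
  set a : ℝ := s - ℓ / (2 * s) with ha
  have hls : ℓ / (2 * s) ≤ (1 - δ) * s / 2 := by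
    rw [div_le_iff₀ (by positivity)]
    nlinarith
  have hls0 : 0 ≤ ℓ / (2 * s) := by positivity
  have has : s / 2 ≤ a := by nlinarith
  set w : ℝ := (a - δ * s) / c with hw
  have hcw : c * w = a - δ * s := by rw [hw]; field_simp
  have hwlow : (1 - δ) * s / 2 ≤ c * w := by rw [hcw]; linarith
  have hwup : c * w ≤ (1 - δ) * s := by rw [hcw]; linarith
  have hw0 : 0 < w := by
    have : 0 < c * w := lt_of_lt_of_le (by positivity) hwlow
    exact (pos_iff_pos_of_mul_pos this).1 hc
  have hpw : 2 * w ≤ p * s * c / 4 := by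
    rw [div_le_iff₀ (by positivity)] at hp
    have h1 : c * (2 * w) ≤ c * (p * s * c / 4) := by nlinarith
    exact le_of_mul_le_mul_left h1 hc
  have hpt : ∀ x, stdNormalCDF (δ * s + c * x) ^ n ≤
      Real.exp (-(n * tailConst)) + K * Real.exp (-(2 * w * max (w - x) 0)) := by
    intro x
    set t : ℝ := δ * s + c * x with ht
    rcases lt_or_ge t 0 with h | h
    · have h0 : stdNormalCDF t ≤ 1 - tailConst :=
        (monotone_stdNormalCDF h.le).trans (by simpa using stdNormalCDF_le_one_sub le_rfl)
      have : 0 ≤ K * Real.exp (-(2 * w * max (w - x) 0)) := by positivity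
      linarith [stdNormalCDF_pow_le_exp h0 n]
    suffices stdNormalCDF t ^ n ≤ K * Real.exp (-(2 * w * max (w - x) 0)) by
      linarith [Real.exp_pos (-(n * tailConst))]
    rcases le_total w x with hx | hx
    · rw [max_eq_right (by linarith), mul_zero, neg_zero, Real.exp_zero, mul_one]
      exact (pow_le_one₀ (stdNormalCDF_nonneg t) (stdNormalCDF_le_one t)).trans hK1
    · have hta : a - t = c * (w - x) := by rw [ht, mul_sub, hcw]; ring
      have hta' : t ≤ a := by nlinarith
      have h1 := exp_le_mul_tail hL hs ha has h hta'
      rw [hexpL, ← hk] at h1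
      rw [max_eq_left (by linarith)]
      set y : ℝ := Real.exp (s * (a - t) / 4) with hy
      have hy0 : 0 < y := Real.exp_pos _
      calc stdNormalCDF t ^ n
          ≤ Real.exp (-(n * (tailConst * Real.exp (-(t ^ 2 / 2)) / (1 + t)))) :=
            stdNormalCDF_pow_le_exp (stdNormalCDF_le_one_sub h) n
        _ ≤ Real.exp (-(k * y)) := Real.exp_le_exp.2 (neg_le_neg h1)
        _ ≤ p.factorial / (k * y) ^ p := exp_neg_le_factorial_div_pow (by positivity) p
        _ = p.factorial / k ^ p * Real.exp (-(p * (s * (a - t) / 4))) := by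
            rw [mul_pow, hy, ← Real.exp_nat_mul, Real.exp_neg]
            field_simp
        _ ≤ K * Real.exp (-(2 * w * (w - x))) := by
            refine mul_le_mul (by rw [hK]; linarith) (Real.exp_le_exp.2 (neg_le_neg ?_))
              (Real.exp_pos _).le (by positivity)
            rw [hta]
            nlinarith [mul_le_mul_of_nonneg_right hpw (sub_nonneg.2 hx)]
  refine (integral_gaussianReal_le hw0 (by positivity)
    (fun x => pow_nonneg (stdNormalCDF_nonneg _) n) hpt).trans ?_
  -- Here `exp (-(ℓ / 2)) = 1 / √L`: the factor `1 / w` of the normal tail produces the `-1` in the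
  -- exponent `((1 - δ) / c ^ 2 - 1) / 2`.
  have hwinv : 2 / w ≤ 4 * c / (1 - δ) * Real.exp (-(ℓ / 2)) := by
    have hsl : Real.exp (ℓ / 2) ≤ s := by
      rw [hℓ, ← Real.log_sqrt hL0.le, Real.exp_log (Real.sqrt_pos.2 hL0), hs]
      exact Real.sqrt_le_sqrt (by linarith)
    rw [Real.exp_neg, div_mul_eq_mul_div, ← div_eq_mul_inv, div_div,
      div_le_div_iff₀ hw0 (by positivity)]
    nlinarith [mul_le_mul_of_nonneg_left hsl hd0.le]
  -- In `(c * w) ^ 2` the cross term of `(1 - δ) * s` and `ℓ / (2 * s)` is `(1 - δ) * ℓ`, the source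
  -- of the remaining power of `log n`; the last square is dropped.
  have hwexp : Real.exp (-(w ^ 2 / 2)) ≤
      Real.exp (-((1 - δ) ^ 2 / c ^ 2 * L) + (1 - δ) / c ^ 2 * (ℓ / 2)) := by
    rw [Real.exp_le_exp]
    have h1 : (c * w) ^ 2 ≥ (1 - δ) ^ 2 * (2 * L) - (1 - δ) * ℓ := by
      have e : c * w = (1 - δ) * s - ℓ / (2 * s) := by rw [hcw, ha]; ring
      have e2 : s * (ℓ / (2 * s)) = ℓ / 2 := by field_simp
      have e3 : ((1 - δ) * s - ℓ / (2 * s)) ^ 2 = (1 - δ) ^ 2 * s ^ 2 -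
          2 * (1 - δ) * (s * (ℓ / (2 * s))) + (ℓ / (2 * s)) ^ 2 := by ring
      rw [e, e3, e2, hs2]
      linarith [sq_nonneg (ℓ / (2 * s))]
    have h2 : w ^ 2 = (c * w) ^ 2 / c ^ 2 := by field_simp
    rw [h2]
    have h3 : ((1 - δ) ^ 2 * (2 * L) - (1 - δ) * ℓ) / c ^ 2 ≤ (c * w) ^ 2 / c ^ 2 :=
      div_le_div_of_nonneg_right h1 (by positivity)
    have h4 : ((1 - δ) ^ 2 * (2 * L) - (1 - δ) * ℓ) / c ^ 2 =
        2 * ((1 - δ) ^ 2 / c ^ 2 * L) - 2 * ((1 - δ) / c ^ 2 * (ℓ / 2)) := by ring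
    linarith
  have hrhs : (n : ℝ) ^ (-((1 - δ) ^ 2 / c ^ 2)) * L ^ (((1 - δ) / c ^ 2 - 1) / 2) =
      Real.exp (-(ℓ / 2)) *
        Real.exp (-((1 - δ) ^ 2 / c ^ 2 * L) + (1 - δ) / c ^ 2 * (ℓ / 2)) := by
    rw [Real.rpow_def_of_pos hn0, Real.rpow_def_of_pos hL0, ← Real.exp_add, ← Real.exp_add]
    congr 1
    ring
  rw [hrhs]
  have : 2 / w * Real.exp (-(w ^ 2 / 2)) ≤ 4 * c / (1 - δ) * Real.exp (-(ℓ / 2)) *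
      Real.exp (-((1 - δ) ^ 2 / c ^ 2 * L) + (1 - δ) / c ^ 2 * (ℓ / 2)) :=
    mul_le_mul hwinv hwexp (Real.exp_pos _).le (by positivity)
  have := mul_le_mul_of_nonneg_left this (zero_le_one.trans hK1)
  linarith

/-- An exponentially small quantity is dominated by any power times a power of a logarithm. -/
lemma exists_exp_neg_mul_le {q : ℝ} (hq : 0 < q) (α : ℝ) {γ : ℝ} (hγ : -(1 / 2) ≤ γ) :
    ∃ K : ℝ, 0 < K ∧ ∀ n : ℕ, 1 ≤ Real.log n →
      Real.exp (-(n * q)) ≤ K * ((n : ℝ) ^ (-α) * Real.log n ^ γ) := by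
  -- The extra `1 / 2` pays for the logarithm: `n ^ (-1/2) ≤ (log n) ^ (-1/2) ≤ (log n) ^ γ`.
  obtain ⟨p, hp⟩ := exists_nat_ge (α + 1 / 2)
  refine ⟨p.factorial / q ^ p, by positivity, fun n hL => ?_⟩
  have hn0 : (0 : ℝ) < n := by
    rcases Nat.eq_zero_or_pos n with h | h
    · simp [h] at hL
      linarith
    · exact_mod_cast h
  have hL0 : 0 < Real.log n := by linarith
  have hn1 : (1 : ℝ) ≤ n := by
    have := Real.log_le_sub_one_of_pos hn0
    linarith
  refine (exp_neg_le_factorial_div_pow (by positivity) p).trans ?_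
  rw [mul_pow, mul_comm ((n : ℝ) ^ p), ← div_div, div_eq_mul_inv _ ((n : ℝ) ^ p)]
  refine mul_le_mul_of_nonneg_left ?_ (by positivity)
  calc ((n : ℝ) ^ p)⁻¹ = (n : ℝ) ^ (-(p : ℝ)) := by
        rw [Real.rpow_neg hn0.le, Real.rpow_natCast]
    _ ≤ (n : ℝ) ^ (-α + -(1 / 2)) := Real.rpow_le_rpow_of_exponent_le hn1 (by linarith)
    _ = (n : ℝ) ^ (-α) * (n : ℝ) ^ (-(1 / 2) : ℝ) := Real.rpow_add hn0 _ _
    _ ≤ (n : ℝ) ^ (-α) * Real.log n ^ γ := by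
        refine mul_le_mul_of_nonneg_left ?_ (by positivity)
        refine le_trans ?_ (Real.rpow_le_rpow_of_exponent_le hL hγ)
        refine Real.rpow_le_rpow_of_nonpos hL0 ?_ (by norm_num)
        linarith [Real.log_le_sub_one_of_pos hn0]

/-- The lower tail bound for the maximum of an equicorrelated Gaussian vector, as a one-dimensional
integral. -/
lemma exists_integral_stdNormalCDF_pow_le {δ c : ℝ} (hδ : δ ∈ Set.Ioo (0 : ℝ) 1) (hc : 0 < c) :
    ∃ C : ℝ, 0 < C ∧ ∀ n : ℕ, 2 ≤ n →
      ∫ x, stdNormalCDF (δ * √(2 * Real.log n) + c * x) ^ n ∂(gaussianReal 0 1) ≤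
        C * (n : ℝ) ^ (-((1 - δ) ^ 2 / c ^ 2)) *
          Real.log n ^ (((1 - δ) / c ^ 2 - 1) / 2) := by
  obtain ⟨K₁, hK₁, h₁⟩ := integral_stdNormalCDF_pow_le hδ hc
  have hd0 : 0 < 1 - δ := by linarith [hδ.2]
  obtain ⟨K₂, hK₂, h₂⟩ := exists_exp_neg_mul_le tailConst_pos ((1 - δ) ^ 2 / c ^ 2)
    (γ := ((1 - δ) / c ^ 2 - 1) / 2) (by
      have : 0 ≤ (1 - δ) / c ^ 2 := by positivity
      linarith)
  set G : ℕ → ℝ := fun n => (n : ℝ) ^ (-((1 - δ) ^ 2 / c ^ 2)) *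
    Real.log n ^ (((1 - δ) / c ^ 2 - 1) / 2)
  have hG : ∀ n : ℕ, 2 ≤ n → 0 < G n := by
    intro n hn
    have hn' : (2 : ℝ) ≤ n := by exact_mod_cast hn
    have : 0 < Real.log n := Real.log_pos (by linarith)
    have : (0 : ℝ) < n := by linarith
    positivity
  have hlog : Filter.Tendsto (fun n : ℕ => Real.log n) Filter.atTop Filter.atTop :=
    Real.tendsto_log_atTop.comp tendsto_natCast_atTop_atTop
  have hev : ∀ᶠ x : ℝ in Filter.atTop, Real.log x ≤ 2 * (1 - δ) * x := by
    have := Real.isLittleO_log_id_atTop.bound (c := 2 * (1 - δ)) (by linarith)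
    filter_upwards [this, Filter.eventually_ge_atTop 0] with x hx hx0
    rw [id, Real.norm_eq_abs, Real.norm_eq_abs, abs_of_nonneg hx0] at hx
    exact (le_abs_self _).trans hx
  obtain ⟨N, hN⟩ := Filter.eventually_atTop.1
    ((hlog.eventually (Filter.eventually_ge_atTop 1)).and (hlog.eventually hev))
  -- For the finitely many `n < N` the integral is at most `1`, so adding the reciprocals of `G`
  -- suffices. Absolute values keep the meaningless terms `m = 0, 1` harmless.
  refine ⟨K₁ + K₂ + ∑ m ∈ Finset.range N, |(G m)⁻¹|, by positivity, fun n hn => ?_⟩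
  rw [mul_assoc]
  change _ ≤ _ * G n
  have hGn := hG n hn
  have hS : 0 ≤ ∑ m ∈ Finset.range N, |(G m)⁻¹| := Finset.sum_nonneg fun _ _ => abs_nonneg _
  rcases lt_or_ge n N with h | h
  · have hle1 : ∫ x, stdNormalCDF (δ * √(2 * Real.log n) + c * x) ^ n ∂(gaussianReal 0 1) ≤ 1 := by
      refine (integral_mono_of_nonneg (Filter.Eventually.of_forall fun x =>
        pow_nonneg (stdNormalCDF_nonneg _) n) (integrable_const (1 : ℝ))
        (Filter.Eventually.of_forall fun x =>
          pow_le_one₀ (stdNormalCDF_nonneg _) (stdNormalCDF_le_one _))).trans (le_of_eq ?_)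
      simp
    have hterm : (G n)⁻¹ ≤ ∑ m ∈ Finset.range N, |(G m)⁻¹| :=
      (le_abs_self _).trans (Finset.single_le_sum (f := fun m => |(G m)⁻¹|)
        (fun _ _ => abs_nonneg _) (Finset.mem_range.2 h))
    calc _ ≤ (1 : ℝ) := hle1
      _ = (G n)⁻¹ * G n := (inv_mul_cancel₀ hGn.ne').symm
      _ ≤ _ := mul_le_mul_of_nonneg_right (by linarith) hGn.le
  · obtain ⟨hn1, hn2⟩ := hN n h
    have A := h₁ n hn1 hn2
    have B := h₂ n hn1
    change _ ≤ _ + K₁ * G n at A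
    change _ ≤ K₂ * G n at B
    nlinarith [mul_nonneg hS hGn.le]

/-! ### The equicorrelated Gaussian vector -/

section Equicorrelated

variable {ι : Type*} [Fintype ι]

/-- The standard Gaussian measure on `ι → ℝ`. -/
noncomputable def piStdGaussian (ι : Type*) [Fintype ι] : Measure (ι → ℝ) :=
  Measure.pi fun _ => gaussianReal 0 1

instance isProbabilityMeasure_piStdGaussian : IsProbabilityMeasure (piStdGaussian ι) := by
  unfold piStdGaussian
  infer_instance

lemma integral_sq_gaussianReal : ∫ x, x * x ∂(gaussianReal 0 1) = 1 := by
  have h := variance_fun_id_gaussianReal (μ := 0) (v := 1)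
  rw [variance_of_integral_eq_zero (by fun_prop) integral_id_gaussianReal] at h
  simpa [pow_two] using h

lemma iIndepFun_piStdGaussian :
    iIndepFun (fun (i : ι) (x : ι → ℝ) => x i) (piStdGaussian ι) :=
  iIndepFun_pi (X := fun _ x => x) fun _ => aemeasurable_id

lemma map_eval_piStdGaussian (i : ι) :
    (piStdGaussian ι).map (fun x => x i) = gaussianReal 0 1 :=
  (measurePreserving_eval (fun _ : ι => gaussianReal 0 1) i).map_eq

instance isGaussian_piStdGaussian : IsGaussian (piStdGaussian ι) := by
  have h := iIndepFun.hasGaussianLaw (X := fun (i : ι) (x : ι → ℝ) => x i)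
    (P := piStdGaussian ι) (fun i => ⟨by rw [map_eval_piStdGaussian]; infer_instance⟩)
    iIndepFun_piStdGaussian
  simpa using h.isGaussian_map

lemma integral_eval_piStdGaussian (i : ι) : ∫ x, x i ∂(piStdGaussian ι) = 0 := by
  have h := integral_map (μ := piStdGaussian ι) (φ := fun x => x i) (f := fun y : ℝ => y)
    (measurable_pi_apply i).aemeasurable (by fun_prop)
  rw [map_eval_piStdGaussian, integral_id_gaussianReal] at h
  exact h.symm

lemma integral_eval_mul_eval_piStdGaussian [DecidableEq ι] (i j : ι) :
    ∫ x, x i * x j ∂(piStdGaussian ι) = if i = j then 1 else 0 := by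
  split_ifs with hij
  · subst hij
    have h := integral_map (μ := piStdGaussian ι) (φ := fun x => x i) (f := fun y : ℝ => y * y)
      (measurable_pi_apply i).aemeasurable (by fun_prop)
    rw [map_eval_piStdGaussian, integral_sq_gaussianReal] at h
    exact h.symm
  · have h := (iIndepFun_piStdGaussian.indepFun hij).integral_fun_mul_eq_mul_integral
      (μ := piStdGaussian ι)
      (measurable_pi_apply i).aestronglyMeasurable (measurable_pi_apply j).aestronglyMeasurable
    rw [h, integral_eval_piStdGaussian, zero_mul]

/-- The linear map `(w, ξ) ↦ (√(1 - ρ) ξᵢ - √ρ w)ᵢ`. -/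
noncomputable def equicorrMap (ι : Type*) [Fintype ι] (ρ : ℝ) : ℝ × (ι → ℝ) →L[ℝ] (ι → ℝ) :=
  ContinuousLinearMap.pi fun i =>
    √(1 - ρ) • (ContinuousLinearMap.proj (R := ℝ) (φ := fun _ : ι => ℝ) i ∘L
      ContinuousLinearMap.snd ℝ ℝ (ι → ℝ)) - √ρ • ContinuousLinearMap.fst ℝ ℝ (ι → ℝ)

@[simp] lemma equicorrMap_apply (ρ : ℝ) (p : ℝ × (ι → ℝ)) (i : ι) :
    equicorrMap ι ρ p i = √(1 - ρ) * p.2 i - √ρ * p.1 := by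
  simp [equicorrMap]

/-- The centred Gaussian measure with unit variances and all correlations equal to `ρ`. -/
noncomputable def equicorrGaussian (ι : Type*) [Fintype ι] (ρ : ℝ) : Measure (ι → ℝ) :=
  ((gaussianReal 0 1).prod (piStdGaussian ι)).map (equicorrMap ι ρ)

instance isGaussian_equicorrGaussian (ρ : ℝ) : IsGaussian (equicorrGaussian ι ρ) := by
  unfold equicorrGaussian
  infer_instance

lemma memLp_eval_of_isGaussian (μ : Measure (ι → ℝ)) [IsGaussian μ] (i : ι) :
    MemLp (fun x => x i) 2 μ :=
  IsGaussian.memLp_two_id.mono (measurable_pi_apply i).aestronglyMeasurable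
    (Filter.Eventually.of_forall fun x => norm_le_pi_norm x i)

lemma integral_eval_equicorrGaussian (ρ : ℝ) (i : ι) :
    ∫ x, x i ∂(equicorrGaussian ι ρ) = 0 := by
  rw [equicorrGaussian, integral_map (f := fun x : ι → ℝ => x i) (by fun_prop)
    (measurable_pi_apply i).aestronglyMeasurable]
  simp only [equicorrMap_apply]
  have i1 : Integrable (fun x : ι → ℝ => x i) (piStdGaussian ι) :=
    (memLp_eval_of_isGaussian _ i).integrable (by norm_num)
  have i2 : Integrable (fun x : ℝ => x) (gaussianReal 0 1) := IsGaussian.integrable_id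
  rw [integral_sub ((i1.comp_snd _).const_mul _) ((i2.comp_fst _).const_mul _),
    integral_const_mul, integral_const_mul, integral_fun_snd (fun x : ι → ℝ => x i),
    integral_fun_fst (fun x : ℝ => x), integral_eval_piStdGaussian, integral_id_gaussianReal]
  simp

lemma integral_eval_mul_eval_equicorrGaussian [DecidableEq ι] {ρ : ℝ} (h0 : 0 ≤ ρ) (h1 : ρ ≤ 1)
    (i j : ι) : ∫ x, x i * x j ∂(equicorrGaussian ι ρ) = if i = j then 1 else ρ := by
  rw [equicorrGaussian, integral_map (by fun_prop) (by fun_prop)]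
  have i1 : ∀ i, Integrable (fun x : ι → ℝ => x i) (piStdGaussian ι) := fun i =>
    (memLp_eval_of_isGaussian _ i).integrable (by norm_num)
  have i11 : Integrable (fun x : ι → ℝ => x i * x j) (piStdGaussian ι) :=
    (memLp_eval_of_isGaussian _ i).integrable_mul (memLp_eval_of_isGaussian _ j)
  have i2 : Integrable (fun x : ℝ => x) (gaussianReal 0 1) := IsGaussian.integrable_id
  have i22 : Integrable (fun x : ℝ => x * x) (gaussianReal 0 1) :=
    (IsGaussian.memLp_two_id (μ := gaussianReal 0 1)).integrable_mul IsGaussian.memLp_two_id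
  have e : ∀ p : ℝ × (ι → ℝ), equicorrMap ι ρ p i * equicorrMap ι ρ p j =
      (1 - ρ) * (p.2 i * p.2 j) - √(1 - ρ) * √ρ * (p.1 * p.2 i) -
        √(1 - ρ) * √ρ * (p.1 * p.2 j) + ρ * (p.1 * p.1) := by
    intro p
    rw [equicorrMap_apply, equicorrMap_apply]
    linear_combination (p.2 i * p.2 j) * Real.mul_self_sqrt (sub_nonneg.2 h1) +
      (p.1 * p.1) * Real.mul_self_sqrt h0
  simp_rw [e]
  have J1 := (i11.comp_snd (gaussianReal 0 1)).const_mul (1 - ρ)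
  have J2 : ∀ k, Integrable (fun p : ℝ × (ι → ℝ) => √(1 - ρ) * √ρ * (p.1 * p.2 k))
      ((gaussianReal 0 1).prod (piStdGaussian ι)) := fun k => (i2.mul_prod (i1 k)).const_mul _
  have J3 := (i22.comp_fst (piStdGaussian ι)).const_mul ρ
  have J12 : Integrable (fun p : ℝ × (ι → ℝ) =>
      (1 - ρ) * (p.2 i * p.2 j) - √(1 - ρ) * √ρ * (p.1 * p.2 i))
      ((gaussianReal 0 1).prod (piStdGaussian ι)) := J1.sub (J2 i)
  have J122 : Integrable (fun p : ℝ × (ι → ℝ) =>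
      (1 - ρ) * (p.2 i * p.2 j) - √(1 - ρ) * √ρ * (p.1 * p.2 i) -
        √(1 - ρ) * √ρ * (p.1 * p.2 j))
      ((gaussianReal 0 1).prod (piStdGaussian ι)) := J12.sub (J2 j)
  have cross : ∀ k : ι, ∫ p : ℝ × (ι → ℝ), p.1 * p.2 k
      ∂((gaussianReal 0 1).prod (piStdGaussian ι)) = 0 := fun k => by
    rw [integral_prod_mul (fun x : ℝ => x) (fun x : ι → ℝ => x k), integral_id_gaussianReal,
      zero_mul]
  rw [integral_add J122 J3, integral_sub J12 (J2 j), integral_sub J1 (J2 i),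
    integral_const_mul, integral_const_mul, integral_const_mul, integral_const_mul, cross, cross,
    integral_fun_snd (fun x : ι → ℝ => x i * x j), integral_fun_fst (fun x : ℝ => x * x),
    integral_eval_mul_eval_piStdGaussian, integral_sq_gaussianReal]
  split_ifs <;> simp

lemma measurableSet_forall_le (u : ℝ) : MeasurableSet {x : ι → ℝ | ∀ i, x i ≤ u} := by
  rw [Set.ofPred_forall]
  exact MeasurableSet.iInter fun i => measurableSet_le (measurable_pi_apply i) measurable_const

/-- Given the common factor `w`, the coordinates are independent, so the conditional probability is
a power of the normal distribution function. -/
lemma equicorrGaussian_real_forall_le {ρ : ℝ} (h1 : ρ < 1) (u : ℝ) :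
    (equicorrGaussian ι ρ).real {x | ∀ i, x i ≤ u} =
      ∫ w, stdNormalCDF ((u + √ρ * w) / √(1 - ρ)) ^ Fintype.card ι ∂(gaussianReal 0 1) := by
  have hr : 0 < √(1 - ρ) := Real.sqrt_pos.2 (by linarith)
  have hm := (equicorrMap ι ρ).continuous.measurable
  rw [equicorrGaussian, map_measureReal_apply hm (measurableSet_forall_le u), measureReal_def,
    Measure.prod_apply (hm (measurableSet_forall_le u)), ← integral_toReal]
  · refine integral_congr_ae (Filter.Eventually.of_forall fun w => ?_)
    have hs : Prod.mk w ⁻¹' (equicorrMap ι ρ ⁻¹' {x | ∀ i, x i ≤ u}) =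
        Set.univ.pi fun _ : ι => Set.Iic ((u + √ρ * w) / √(1 - ρ)) := by
      ext x
      simp only [Set.mem_preimage, Set.mem_ofPred_eq, equicorrMap_apply, Set.mem_pi, Set.mem_univ,
        true_implies, Set.mem_Iic]
      refine forall_congr' fun i => ?_
      rw [le_div_iff₀ hr]
      constructor <;> intro h <;> linarith
    simp only [hs, piStdGaussian, Measure.pi_pi, Finset.prod_const, Finset.card_univ,
      ENNReal.toReal_pow]
    rfl
  · exact (measurable_measure_prodMk_left (hm (measurableSet_forall_le u))).aemeasurable
  · exact Filter.Eventually.of_forall fun w => measure_lt_top _ _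

end Equicorrelated

/-! ### Standardized vectors and admissible constants -/

section StandardizedVectors

variable {Ω : Type*} [MeasurableSpace Ω] {P : Measure Ω} {n : ℕ} {X : Ω → Fin n → ℝ}

lemma vecMax_le_iff (hn : 2 ≤ n) (x : Fin n → ℝ) (u : ℝ) : vecMax x ≤ u ↔ ∀ i, x i ≤ u := by
  have : Nonempty (Fin n) := ⟨⟨0, by omega⟩⟩
  exact ciSup_le_iff (Set.finite_range x).bddAbove

lemma covariance_eq_integral_mul (h0 : ∀ i, ∫ ω, X ω i ∂P = 0) (i j : Fin n) :
    cov[fun ω => X ω i, fun ω => X ω j; P] = ∫ ω, X ω i * X ω j ∂P := by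
  simp [covariance, h0]

lemma isStdGaussianVector_iff :
    IsStdGaussianVector P X ↔ HasGaussianLaw X P ∧ (∀ i, ∫ ω, X ω i ∂P = 0) ∧
      ∀ i, ∫ ω, X ω i * X ω i ∂P = 1 := by
  have key : HasGaussianLaw X P → (∀ i, ∫ ω, X ω i ∂P = 0) → ∀ i,
      Var[fun ω => X ω i; P] = ∫ ω, X ω i * X ω i ∂P := fun hX h0 i => by
    rw [← covariance_eq_integral_mul h0, covariance_self (hX.aemeasurable.eval i)]
  constructor
  · rintro ⟨h1, h2, h3⟩
    exact ⟨h1, h2, fun i => by rw [← key h1 h2, h3]⟩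
  · rintro ⟨h1, h2, h3⟩
    exact ⟨h1, h2, fun i => by rw [key h1 h2, h3]⟩

lemma IsStdGaussianVector.corrMatrix_eq (hX : IsStdGaussianVector P X) (i j : Fin n) :
    corrMatrix P X i j = ∫ ω, X ω i * X ω j ∂P := by
  rw [corrMatrix, hX.variance_eq_one, hX.variance_eq_one,
    covariance_eq_integral_mul hX.mean_eq_zero]
  simp

lemma ProbabilityTheory.HasGaussianLaw.integral_map_eval_mul (hX : HasGaussianLaw X P) (i j : Fin n) :
    ∫ x, x i * x j ∂(P.map X) = ∫ ω, X ω i * X ω j ∂P :=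
  integral_map hX.aemeasurable (by fun_prop)

lemma ProbabilityTheory.HasGaussianLaw.integral_map_eval (hX : HasGaussianLaw X P) (i : Fin n) :
    ∫ x, x i ∂(P.map X) = ∫ ω, X ω i ∂P :=
  integral_map hX.aemeasurable (measurable_pi_apply i).aestronglyMeasurable

lemma ProbabilityTheory.HasGaussianLaw.real_forall_le (hX : HasGaussianLaw X P) (u : ℝ) :
    (P.map X).real {x | ∀ i, x i ≤ u} = P.real {ω | ∀ i, X ω i ≤ u} :=
  map_measureReal_apply_of_aemeasurable hX.aemeasurable (measurableSet_forall_le u)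

end StandardizedVectors

/-- The lower tail bound for the maximum of standardized Gaussian vectors with correlations at most
`ρ`. -/
theorem exists_isMaxBoundConstant {δ ρ : ℝ} (hδ : δ ∈ Set.Ioo (0 : ℝ) 1)
    (hρ : ρ ∈ Set.Ioo (0 : ℝ) 1) : ∃ C : ℝ, 0 < C ∧ IsMaxBoundConstant δ ρ C := by
  obtain ⟨hρ0, hρ1⟩ := hρ
  have h1ρ : 0 < 1 - ρ := by linarith
  -- With this slope, `(1 - δ) ^ 2 / c ^ 2` and `(1 - δ) / c ^ 2` are exactly `alphaZero` and
  -- `betaZero`.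
  have hc : 0 < √ρ / √(1 - ρ) := by positivity
  have hc2 : (√ρ / √(1 - ρ)) ^ 2 = ρ / (1 - ρ) := by
    rw [div_pow, Real.sq_sqrt hρ0.le, Real.sq_sqrt h1ρ.le]
  obtain ⟨C, hC, h⟩ := exists_integral_stdNormalCDF_pow_le hδ hc
  refine ⟨C, hC, fun n hn Ω _ P X hX hR => ?_⟩
  obtain ⟨hG, hm, hv⟩ := isStdGaussianVector_iff.1 hX
  have := hG.isGaussian_map
  simp only [vecMax_le_iff hn]
  rw [← hG.real_forall_le]
  have hS := slepian (μ := P.map X) (ν := equicorrGaussian (Fin n) ρ)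
    (fun i => (hG.integral_map_eval i).trans (hm i))
    (integral_eval_equicorrGaussian ρ)
    (fun i => by
      rw [hG.integral_map_eval_mul, hv,
        integral_eval_mul_eval_equicorrGaussian hρ0.le hρ1.le, if_pos rfl])
    (fun i j hij => by
      rw [hG.integral_map_eval_mul, ← hX.corrMatrix_eq,
        integral_eval_mul_eval_equicorrGaussian hρ0.le hρ1.le, if_neg hij]
      exact hR i j hij) (δ * √(2 * (1 - ρ) * Real.log n))
  refine hS.trans ?_
  rw [equicorrGaussian_real_forall_le hρ1, Fintype.card_fin]
  have hα : (1 - δ) ^ 2 / (√ρ / √(1 - ρ)) ^ 2 = alphaZero δ ρ := by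
    rw [hc2, alphaZero]
    field_simp
  have hβ : (1 - δ) / (√ρ / √(1 - ρ)) ^ 2 = betaZero δ ρ := by
    rw [hc2, betaZero]
    field_simp
  have hn' := h n hn
  rw [hα, hβ] at hn'
  refine le_trans (le_of_eq ?_) hn'
  refine integral_congr_ae (Filter.Eventually.of_forall fun w => ?_)
  have hr : √(1 - ρ) ≠ 0 := (Real.sqrt_pos.2 h1ρ).ne'
  have e : √(2 * (1 - ρ) * Real.log n) = √(1 - ρ) * √(2 * Real.log n) := by
    rw [← Real.sqrt_mul h1ρ.le]
    ring_nf
  simp only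
  rw [e]
  congr 2
  field_simp

/-- An admissible constant bounds the lower tail of the maximum on every probability space. -/
lemma IsMaxBoundConstant.real_forall_le {δ ρ C : ℝ} (hC : IsMaxBoundConstant δ ρ C) {n : ℕ}
    (hn : 2 ≤ n) {Ω : Type*} [MeasurableSpace Ω] {P : Measure Ω} {X : Ω → Fin n → ℝ}
    (hG : HasGaussianLaw X P) (h0 : ∀ i, ∫ ω, X ω i ∂P = 0)
    (h1 : ∀ i, ∫ ω, X ω i * X ω i ∂P = 1)
    (hR : ∀ i j, i ≠ j → ∫ ω, X ω i * X ω j ∂P ≤ ρ) :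
    P.real {ω | ∀ i, X ω i ≤ δ * √(2 * (1 - ρ) * Real.log n)} ≤
      C * (n : ℝ) ^ (-alphaZero δ ρ) * Real.log n ^ ((betaZero δ ρ - 1) / 2) := by
  have := hG.isGaussian_map
  -- Admissibility quantifies over spaces in `Type` only, so it is applied to the law of `X` on `Fin
  -- n → ℝ`.
  have hstd : IsStdGaussianVector (P.map X) (fun x => x) :=
    isStdGaussianVector_iff.2 ⟨IsGaussian.hasGaussianLaw_id,
      fun i => (hG.integral_map_eval i).trans (h0 i),
      fun i => (hG.integral_map_eval_mul i i).trans (h1 i)⟩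
  have h := hC n hn (Fin n → ℝ) (P.map X) (fun x => x) hstd fun i j hij => by
    rw [hstd.corrMatrix_eq, hG.integral_map_eval_mul]
    exact hR i j hij
  simp only [vecMax_le_iff hn] at h
  rwa [hG.real_forall_le] at h

/-! ### Bounds for the sup norm -/

section SignedCoordinates

variable {n : ℕ}

/-- The coordinates of a vector followed by their opposites. -/
noncomputable def signedProj (a : Fin n ⊕ Fin n) : (Fin n → ℝ) →L[ℝ] ℝ :=
  a.elim (fun i => ContinuousLinearMap.proj i) fun i => -ContinuousLinearMap.proj i

@[simp] lemma signedProj_inl (i : Fin n) (x : Fin n → ℝ) : signedProj (.inl i) x = x i := rfl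

@[simp] lemma signedProj_inr (i : Fin n) (x : Fin n → ℝ) : signedProj (.inr i) x = -x i := rfl

lemma norm_le_iff_signedProj_le {u : ℝ} (hu : 0 ≤ u) (x : Fin n → ℝ) :
    ‖x‖ ≤ u ↔ ∀ a, signedProj a x ≤ u := by
  rw [pi_norm_le_iff_of_nonneg hu, Sum.forall]
  simp only [Real.norm_eq_abs, abs_le', forall_and, signedProj_inl, signedProj_inr]

lemma integral_signedProj {μ : Measure (Fin n → ℝ)} (h0 : ∀ i, ∫ x, x i ∂μ = 0)
    (a : Fin n ⊕ Fin n) : ∫ x, signedProj a x ∂μ = 0 := by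
  rcases a with i | i <;> simp [h0, integral_neg]

lemma integral_signedProj_sq {μ : Measure (Fin n → ℝ)} (h1 : ∀ i, ∫ x, x i * x i ∂μ = 1)
    (a : Fin n ⊕ Fin n) : ∫ x, signedProj a x * signedProj a x ∂μ = 1 := by
  rcases a with i | i <;> simp [h1]

end SignedCoordinates

/-- The two-sided bound for `‖X‖_∞` when all correlations are at most `ρ` in absolute value. -/
lemma IsMaxBoundConstant.real_norm_le {δ ρ C : ℝ} (hC : IsMaxBoundConstant δ ρ C) (hδ : 0 ≤ δ)
    (hρ : 0 ≤ ρ) {n : ℕ} (hn : 1 ≤ n) {μ : Measure (Fin n → ℝ)} [IsGaussian μ]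
    (h0 : ∀ i, ∫ x, x i ∂μ = 0) (h1 : ∀ i, ∫ x, x i * x i ∂μ = 1)
    (hR : ∀ i j, i ≠ j → |∫ x, x i * x j ∂μ| ≤ ρ) :
    μ.real {x | ‖x‖ ≤ δ * √(2 * (1 - ρ) * Real.log (2 * n))} ≤
      C * (2 * n : ℝ) ^ (-alphaZero δ ρ) * Real.log (2 * n) ^ ((betaZero δ ρ - 1) / 2) := by
  set T : (Fin n → ℝ) →L[ℝ] (Fin (n + n) → ℝ) :=
    ContinuousLinearMap.pi fun k => signedProj (finSumFinEquiv.symm k)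
  have hG : HasGaussianLaw (fun x => T x) μ := IsGaussian.hasGaussianLaw_id.map_fun T
  have hoff : ∀ a b : Fin n ⊕ Fin n, a ≠ b → ∫ x, signedProj a x * signedProj b x ∂μ ≤ ρ := by
    rintro (i | i) (j | j) hab
    · exact (abs_le.1 (hR i j fun h => hab (h ▸ rfl))).2
    -- A coordinate and its own opposite have covariance `-1`, below `ρ` because `ρ ≥ 0`; other
    -- mixed pairs need the lower bound `-ρ` on the correlations.
    · simp only [signedProj_inl, signedProj_inr, mul_neg, integral_neg]
      obtain rfl | hij := eq_or_ne i j
      · rw [h1]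
        linarith
      · linarith [(abs_le.1 (hR i j hij)).1]
    · simp only [signedProj_inl, signedProj_inr, neg_mul, integral_neg]
      obtain rfl | hij := eq_or_ne i j
      · rw [h1]
        linarith
      · linarith [(abs_le.1 (hR i j hij)).1]
    · simp only [signedProj_inr, neg_mul_neg]
      exact (abs_le.1 (hR i j fun h => hab (h ▸ rfl))).2
  have h := hC.real_forall_le (n := n + n) (by omega) hG
    (fun k => integral_signedProj h0 _) (fun k => integral_signedProj_sq h1 _)
    fun k l hkl => hoff _ _ (finSumFinEquiv.symm.injective.ne hkl)
  have hcast : ((n + n : ℕ) : ℝ) = 2 * n := by push_cast; ring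
  rw [hcast] at h
  refine le_trans (le_of_eq ?_) h
  congr 1
  ext x
  simp only [Set.mem_ofPred_eq]
  rw [norm_le_iff_signedProj_le (by positivity)]
  exact finSumFinEquiv.forall_congr_left

/-- The two-sided bound for `‖X‖_∞` when all correlations lie in `[0, ρ]`: by Slepian's inequality
the events `max X ≤ u` and `max (-X) ≤ u` are negatively dependent. -/
lemma IsMaxBoundConstant.real_norm_le_sq {δ ρ C : ℝ} (hC : IsMaxBoundConstant δ ρ C) (hδ : 0 ≤ δ)
    {n : ℕ} (hn : 2 ≤ n) {μ : Measure (Fin n → ℝ)} [IsGaussian μ]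
    (h0 : ∀ i, ∫ x, x i ∂μ = 0) (h1 : ∀ i, ∫ x, x i * x i ∂μ = 1)
    (hR : ∀ i j, i ≠ j → ∫ x, x i * x j ∂μ ∈ Set.Icc 0 ρ) :
    μ.real {x | ‖x‖ ≤ δ * √(2 * (1 - ρ) * Real.log n)} ≤
      C ^ 2 * (n : ℝ) ^ (-2 * alphaZero δ ρ) * Real.log n ^ (betaZero δ ρ - 1) := by
  set u : ℝ := δ * √(2 * (1 - ρ) * Real.log n)
  have hu : 0 ≤ u := by positivity
  set S : (Fin n → ℝ) →L[ℝ] (Fin n ⊕ Fin n → ℝ) := ContinuousLinearMap.pi signedProj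
  -- Under `μ.prod μ`, this is `(X, -X')` with `X'` an independent copy of `X`.
  set T : (Fin n → ℝ) × (Fin n → ℝ) →L[ℝ] (Fin n ⊕ Fin n → ℝ) :=
    ContinuousLinearMap.pi fun a => a.elim
      (fun i => signedProj (.inl i) ∘L ContinuousLinearMap.fst ℝ _ _)
      (fun i => signedProj (.inr i) ∘L ContinuousLinearMap.snd ℝ _ _) with hT
  have T1 : ∀ p i, T p (.inl i) = p.1 i := fun _ _ => rfl
  have T2 : ∀ p i, T p (.inr i) = -p.2 i := fun _ _ => rfl
  have hS : μ.real {x | ‖x‖ ≤ u} = (μ.map S).real {y | ∀ a, y a ≤ u} := by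
    rw [map_measureReal_apply S.continuous.measurable (measurableSet_forall_le u)]
    congr 1
    ext x
    exact norm_le_iff_signedProj_le hu x
  have int_map : ∀ {F : Type} [NormedAddCommGroup F] [NormedSpace ℝ F] [MeasurableSpace F]
      [BorelSpace F] (κ : Measure F) (A : F →L[ℝ] (Fin n ⊕ Fin n → ℝ)) (a b : Fin n ⊕ Fin n),
      ∫ y, y a * y b ∂(κ.map A) = ∫ x, A x a * A x b ∂κ := fun κ A a b =>
    integral_map A.continuous.measurable.aemeasurable (by fun_prop)
  have int_map1 : ∀ {F : Type} [NormedAddCommGroup F] [NormedSpace ℝ F] [MeasurableSpace F]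
      [BorelSpace F] (κ : Measure F) (A : F →L[ℝ] (Fin n ⊕ Fin n → ℝ)) (a : Fin n ⊕ Fin n),
      ∫ y, y a ∂(κ.map A) = ∫ x, A x a ∂κ := fun κ A a =>
    integral_map A.continuous.measurable.aemeasurable
      (measurable_pi_apply a).aestronglyMeasurable
  have T3 : ∀ i j, ∫ p, T p (.inl i) * T p (.inl j) ∂(μ.prod μ) = ∫ x, x i * x j ∂μ := by
    intro i j
    simp only [T1]
    rw [integral_fun_fst (fun x : Fin n → ℝ => x i * x j)]
    simp
  have T4 : ∀ i j, ∫ p, T p (.inr i) * T p (.inr j) ∂(μ.prod μ) = ∫ x, x i * x j ∂μ := by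
    intro i j
    simp only [T2, neg_mul_neg]
    rw [integral_fun_snd (fun x : Fin n → ℝ => x i * x j)]
    simp
  have T5 : ∀ i j, ∫ p : (Fin n → ℝ) × (Fin n → ℝ), p.1 i * p.2 j ∂(μ.prod μ) = 0 := by
    intro i j
    rw [integral_prod_mul (fun x : Fin n → ℝ => x i) (fun x : Fin n → ℝ => x j), h0, zero_mul]
  have hnn : ∀ i j, 0 ≤ ∫ x, x i * x j ∂μ := by
    intro i j
    obtain rfl | hij := eq_or_ne i j
    · rw [h1]
      exact zero_le_one
    · exact (hR i j hij).1
  have hSl := slepian (μ := μ.map S) (ν := (μ.prod μ).map T)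
    (fun a => by
      rw [int_map1]
      exact integral_signedProj h0 a)
    (fun a => by
      rw [int_map1]
      rcases a with i | i
      · simp only [T1]
        rw [integral_fun_fst (fun x : Fin n → ℝ => x i), h0, smul_zero]
      · simp only [T2]
        rw [integral_neg, integral_fun_snd (fun x : Fin n → ℝ => x i), h0, smul_zero, neg_zero])
    (fun a => by
      rw [int_map, int_map]
      refine (integral_signedProj_sq h1 a).trans ?_
      rcases a with i | i
      · rw [T3, h1]
      · rw [T4, h1])
    -- Blocks of equal sign have equal covariances. In the mixed blocks `(X, -X)` has `-R i j ≤ 0`,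
    -- including `-1` when `i = j`, while `(X, -X')` has `0`.
    (fun a b hab => by
      rw [int_map, int_map]
      rcases a with i | i <;> rcases b with j | j
      · rw [T3]
        exact le_rfl
      · simp only [T1, T2, mul_neg, integral_neg, T5]
        refine (le_of_eq ?_).trans (neg_nonpos.2 (hnn i j) |>.trans_eq neg_zero.symm)
        rw [← integral_neg]
        simp [S]
      · simp only [T1, T2, neg_mul, integral_neg]
        have : ∫ p : (Fin n → ℝ) × (Fin n → ℝ), p.2 i * p.1 j ∂(μ.prod μ) = 0 := by
          simp_rw [mul_comm, T5]
        rw [this]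
        refine (le_of_eq ?_).trans (neg_nonpos.2 (hnn i j) |>.trans_eq neg_zero.symm)
        rw [← integral_neg]
        simp [S]
      · rw [T4]
        simp [S]) u
  have hprod : ((μ.prod μ).map T).real {y | ∀ a, y a ≤ u} =
      μ.real {x | ∀ i, x i ≤ u} * μ.real {x | ∀ i, -x i ≤ u} := by
    rw [map_measureReal_apply T.continuous.measurable (measurableSet_forall_le u),
      ← measureReal_prod_prod]
    congr 1
    ext p
    simp only [Set.mem_preimage, Set.mem_ofPred_eq, Sum.forall, T1, T2, Set.mem_prod]
  have B1 := hC.real_forall_le (X := fun x : Fin n → ℝ => x) hn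
    (IsGaussian.hasGaussianLaw_id (μ := μ)) h0 h1 fun i j hij => (hR i j hij).2
  -- Negation preserves all covariances, so `-X` obeys the same one-sided bound.
  have B2 := hC.real_forall_le (X := fun x : Fin n → ℝ => -x) hn
    (IsGaussian.hasGaussianLaw_id (μ := μ)).fun_neg (fun i => by simp [integral_neg, h0])
    (fun i => by simp [h1]) fun i j hij => by simpa using (hR i j hij).2
  have hn0 : (0 : ℝ) < n := by
    have : 0 < n := by omega
    exact_mod_cast this
  have hlog : 0 < Real.log n := Real.log_pos (by exact_mod_cast (by omega : 1 < n))
  rw [hS]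
  refine hSl.trans ?_
  rw [hprod]
  refine (mul_le_mul B1 B2 measureReal_nonneg (measureReal_nonneg.trans B1)).trans (le_of_eq ?_)
  have e1 : (n : ℝ) ^ (-2 * alphaZero δ ρ) =
      (n : ℝ) ^ (-alphaZero δ ρ) * (n : ℝ) ^ (-alphaZero δ ρ) := by
    rw [← Real.rpow_add hn0]
    ring_nf
  have e2 : Real.log n ^ (betaZero δ ρ - 1) =
      Real.log n ^ ((betaZero δ ρ - 1) / 2) * Real.log n ^ ((betaZero δ ρ - 1) / 2) := by
    rw [← Real.rpow_add hlog]
    ring_nf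
  rw [e1, e2]
  ring

/-- The norm on `Fin n → ℝ` is the sup norm `‖·‖_∞`. -/
theorem corollary3p2 (δ₀ ρ₀ : ℝ) (hδ₀ : δ₀ ∈ Set.Ioo (0 : ℝ) 1) (hρ₀ : ρ₀ ∈ Set.Ioo (0 : ℝ) 1) :
    (∃ C : ℝ, 0 < C ∧ IsMaxBoundConstant δ₀ ρ₀ C) ∧
    ∀ C : ℝ, 0 < C → IsMaxBoundConstant δ₀ ρ₀ C →
      ∀ (n : ℕ) (Ω : Type*) [MeasurableSpace Ω] (P : Measure Ω) (X : Ω → Fin n → ℝ),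
        IsStdGaussianVector P X →
        (1 ≤ n → (∀ i j, i ≠ j → |corrMatrix P X i j| ≤ ρ₀) →
          P.real {ω | ‖X ω‖ ≤ δ₀ * √(2 * (1 - ρ₀) * Real.log (2 * n))} ≤
            C * (2 * n : ℝ) ^ (-alphaZero δ₀ ρ₀) *
              Real.log (2 * n) ^ ((betaZero δ₀ ρ₀ - 1) / 2)) ∧
        (2 ≤ n → (∀ i j, i ≠ j → corrMatrix P X i j ∈ Set.Icc 0 ρ₀) →
          P.real {ω | ‖X ω‖ ≤ δ₀ * √(2 * (1 - ρ₀) * Real.log n)} ≤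
            C ^ 2 * (n : ℝ) ^ (-2 * alphaZero δ₀ ρ₀) *
              Real.log n ^ (betaZero δ₀ ρ₀ - 1)) := by
  refine ⟨exists_isMaxBoundConstant hδ₀ hρ₀, fun C _ hC n Ω _ P X hX => ?_⟩
  obtain ⟨hG, hm, hv⟩ := isStdGaussianVector_iff.1 hX
  have := hG.isGaussian_map
  have h0 := fun i => (hG.integral_map_eval i).trans (hm i)
  have h1 := fun i => (hG.integral_map_eval_mul i i).trans (hv i)
  have hev : ∀ u : ℝ, P.real {ω | ‖X ω‖ ≤ u} = (P.map X).real {x | ‖x‖ ≤ u} := fun u =>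
    (map_measureReal_apply_of_aemeasurable hG.aemeasurable
      (measurableSet_le measurable_norm measurable_const)).symm
  simp only [hX.corrMatrix_eq, ← hG.integral_map_eval_mul, hev]
  exact ⟨fun hn hR => hC.real_norm_le hδ₀.1.le hρ₀.1.le hn h0 h1 hR,
    fun hn hR => hC.real_norm_le_sq hδ₀.1.le hn h0 h1 hR⟩
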